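/- A $3$-graph $G=(V,E)$ consists of a finite set $V\subseteq\mathbb N$ of vertices and a family $E$ of $3$-element subsets of $V$, called edges. A matching of $G$ is a family of pairwise disjoint edges of $G$. For natural numbers $n,s$ let $\mathcal H_3(n,s)$ be the class of all $3$-graphs with exactly $n$ vertices whose largest matching has exactly $s$ edges, let $\mu_3(n,s)$ be the maximum number of edges of a member of $\mathcal H_3(n,s)$, and let $\mathcal M_3(n,s)$ be the class of those $G\in\mathcal H_3(n,s)$ that have $\mu_3(n,s)$ edges. **Theorem.** There exists $n_0$ such that for all $n\ge n_0$ and all integers $s$ with $1\le s\le (n-2)/3$, $$\mu_3(n,s)=\max\left\{\binom n3-\binom{n-s}3,\ \binom{3s+2}3\right\}.$$ Furthermore, for such $n$ and $s$, every $G=(V,E)\in\mathcal M_3(n,s)$ satisfies at least one of the following: - there is $S\subseteq V$ with $|S|=s$ such that $E$ is the family of all $3$-element subsets of $V$ that meet $S$; - there is $T\subseteq V$ with $|T|=3s+2$ such that $E$ is the family of all $3$-element subsets of $T$. -/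

import Mathlib

namespace Hypergraph

/-- A `k`-graph: every edge has exactly `k` vertices. -/
def IsUniform {α : Type*} (G : Hypergraph α) (k : ℕ) : Prop :=
  ∀ e ∈ G.edgeSet, e.encard = k

/-- A matching of `G`: a family of pairwise disjoint edges of `G`. -/
def IsMatching {α : Type*} (G : Hypergraph α) (M : Set (Set α)) : Prop :=
  M ⊆ G.edgeSet ∧ M.PairwiseDisjoint id

/-- The largest matching of `G` has exactly `s` edges, i.e. `μ(G) = s`. -/
def HasMatchingNumber {α : Type*} (G : Hypergraph α) (s : ℕ) : Prop :=
  (∃ M, G.IsMatching M ∧ M.encard = s) ∧ ∀ M, G.IsMatching M → M.encard ≤ s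

/-- The number of edges `e(G)`. It is used only for hypergraphs with finitely many vertices,
which have finitely many edges. -/
noncomputable def edgeCount {α : Type*} (G : Hypergraph α) : ℕ :=
  G.edgeSet.ncard

/-- The class of all `k`-graphs `G` with vertex set `V ⊆ ℕ`, `|V| = n`, and `μ(G) = s`. -/
def graphClass (k n s : ℕ) : Set (Hypergraph ℕ) :=
  {G | G.IsUniform k ∧ G.vertexSet.encard = n ∧ G.HasMatchingNumber s}

/-- The members of `graphClass k n s` with the maximum number of edges. -/
def extremalClass (k n s : ℕ) : Set (Hypergraph ℕ) :=
  {G | G ∈ graphClass k n s ∧ ∀ G' ∈ graphClass k n s, G'.edgeCount ≤ G.edgeCount}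

/-- The cover graphs `Cov_k(n, s)`: the edges are all `k`-subsets of the `n`-element vertex set
which meet some fixed `s`-subset `S` of it. -/
def coverClass (k n s : ℕ) : Set (Hypergraph ℕ) :=
  {G | G.vertexSet.encard = n ∧ ∃ S ⊆ G.vertexSet, S.encard = s ∧
    G.edgeSet = {e | e ⊆ G.vertexSet ∧ (e ∩ S).Nonempty ∧ e.encard = k}}

/-- The graphs `Cl_k(n, s)`: a complete `k`-graph on `ks + k - 1` of the `n` vertices, all the
other vertices being isolated. -/
def cliqueClass (k n s : ℕ) : Set (Hypergraph ℕ) :=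
  {G | G.vertexSet.encard = n ∧ ∃ T ⊆ G.vertexSet, T.encard = (k * s + k - 1 : ℕ) ∧
    G.edgeSet = {e | e ⊆ T ∧ e.encard = k}}

end Hypergraph

/-!
# The Erdős matching problem for triples

Both constructions have matching number `s`, so the content is the upper bound together with the
description of the families attaining it.

Compressions (replacing an element `j` by a smaller element `i` wherever possible) preserve the
number of triples and do not create larger matchings, so the bound has to be shown for shifted
families `F` on `{0, …, n - 1}` only. The equality cases are recovered by undoing one compression
at a time: if a compression of `F` is one of the two constructions but `F` is not, then two
disjoint triples through `i` and `j`, completed by further members of the construction, form a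
matching of `F` that is too large (`eq_cover_of_compression`, `eq_clique_of_compression`).

For shifted `F` put `m = 3 s + 2`. If `{0, m, m + 1}` belongs to `F`, then deleting the vertex `0`
lowers the matching number, and induction on `s` applies. Otherwise every member of `F` meets
`{0, …, m - 1}` in a triple or in a pair. Let `F₃` and `F₂` be the families of these triples and
pairs. Then `F₂ ∪ F₃` has matching number at most `s` (`matchingLE_traces`) and `F` has at most
`|F₃| + (n - m) |F₂|` members. If `F₂` is empty, `F` lies in a clique. If not, it suffices to show
that `F₃` misses at least `0.49 s |F₂|` triples (`exists_missing_bound`): for `n - m < 0.49 s` the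
clique on `m` vertices then is larger than `F`, and for larger `n` the cover construction is
(`trace_bound_lt_of_large`). For bounded `s` and large `n`, a crude estimate is enough.

There are two estimates for the missing triples. Let `r` be the matching number of `F₂`. If `r` is
small compared to `s`, fix a matching of `F₂` on `{0, …, 2 r - 1}` and average over all placements
of disjoint triples on the other vertices (`card_missing_of_matching`). If `r` is at least a
constant multiple of `s`, then `s |F₂|` has the order of magnitude `s ^ 3`, and an asymptotic bound
is enough (`exists_missing_asymptotic`). For this the vertices are divided into a large constant
number of blocks of equal size. As `F` is shifted, a family on the set of blocks describes it up to
a small error, and every fractional matching of this reduced family has weight at most a third of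
the number of blocks. Linear programming duality provides a fractional cover `w` such that the
distribution of the values of `w` is a mixture of triples with sum at most `1`
(`exists_cover_matching`, `exists_weight`). Now pairs in `F₂` have weight at least `1`, triples of
weight less than `1` are missing, and comparing the two comes down to `local_inequality`, which
concerns three such triples of values.
-/

namespace ErdosMatching

open Finset

/-! ### A local inequality for triples of weights -/

lemma card_lt_add_card_lt {x y z u v : ℝ} (hx : 0 ≤ x) (hy : 0 ≤ y) (hz : 0 ≤ z)
    (h : x + y + z ≤ 1) (huv : u + v ≤ 1) :
    2 ≤ ((if u + x < 1 then 1 else 0) + (if u + y < 1 then 1 else 0)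
        + (if u + z < 1 then 1 else 0) : ℝ)
      + ((if v + x < 1 then 1 else 0) + (if v + y < 1 then 1 else 0)
        + (if v + z < 1 then 1 else 0)) := by
  split_ifs <;> first | (norm_num; done) | (exfalso; linarith)

/-- Let `(x₁, y₁, z₁)`, `(x₂, y₂, z₂)`, `(x, y, z)` have non-negative entries with sum at most
`1`, the first two in decreasing order. The number of choices of one entry from each of them with
sum below `1` is at least `3 / 2` times the number of choices of one entry from each of the first
two with sum at least `1`. -/
lemma local_inequality {x₁ y₁ z₁ x₂ y₂ z₂ x y z : ℝ}
    (h₁ : y₁ ≤ x₁) (h₁' : z₁ ≤ y₁) (h₁'' : 0 ≤ z₁) (hs₁ : x₁ + y₁ + z₁ ≤ 1)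
    (h₂ : y₂ ≤ x₂) (h₂' : z₂ ≤ y₂) (h₂'' : 0 ≤ z₂) (hs₂ : x₂ + y₂ + z₂ ≤ 1)
    (hx : 0 ≤ x) (hy : 0 ≤ y) (hz : 0 ≤ z) (hs : x + y + z ≤ 1)
    (p : ℝ → ℝ) (hp : p = fun u => if 1 ≤ u then 1 else 0)
    (N : ℝ → ℝ) (hN : N = fun u => (if u + x < 1 then 1 else 0) + (if u + y < 1 then 1 else 0)
        + (if u + z < 1 then 1 else 0)) :
    3 * ((p (x₁ + x₂) + p (x₁ + y₂) + p (x₁ + z₂)) + (p (y₁ + x₂) + p (y₁ + y₂) + p (y₁ + z₂))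
        + (p (z₁ + x₂) + p (z₁ + y₂) + p (z₁ + z₂)))
      ≤ 2 * ((N (x₁ + x₂) + N (x₁ + y₂) + N (x₁ + z₂)) + (N (y₁ + x₂) + N (y₁ + y₂) + N (y₁ + z₂))
        + (N (z₁ + x₂) + N (z₁ + y₂) + N (z₁ + z₂))) := by
  have key : ∀ u v, u + v ≤ 1 → 2 ≤ N u + N v := fun u v huv => by
    rw [hN]; exact card_lt_add_card_lt hx hy hz hs huv
  have N0 : ∀ u, 0 ≤ N u := fun u => by rw [hN]; positivity
  have p1 : ∀ u, p u ≤ 1 := fun u => by rw [hp]; dsimp only; split_ifs <;> norm_num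
  have p0 : ∀ u, u < 1 → p u = 0 := fun u hu => by rw [hp]; dsimp only; rw [if_neg (by linarith)]
  have z0 : z₁ + z₂ < 1 := by linarith
  have z1 : y₁ + z₂ < 1 := by linarith
  have z2 : z₁ + y₂ < 1 := by linarith
  have hN1 : ∀ u, u ≤ 1 / 2 → 1 ≤ N u := fun u hu => by
    have := key u u (by linarith); linarith
  have hN2 : ∀ u, u ≤ 0 → 2 ≤ N u := fun u hu => by
    rw [hN]; dsimp only
    split_ifs <;> first | (norm_num; done) | (exfalso; linarith)
  rcases le_or_gt 1 (y₁ + y₂) with c | c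
  · -- both triples are `(1/2, 1/2, 0)`
    have a1 := hN1 (x₁ + z₂) (by linarith)
    have a2 := hN1 (y₁ + z₂) (by linarith)
    have a3 := hN1 (z₁ + x₂) (by linarith)
    have a4 := hN1 (z₁ + y₂) (by linarith)
    have a5 := hN2 (z₁ + z₂) (by linarith)
    rw [p0 _ z0, p0 _ z1, p0 _ z2, p0 (x₁ + z₂) (by linarith), p0 (z₁ + x₂) (by linarith)]
    linarith [p1 (x₁ + x₂), p1 (x₁ + y₂), p1 (y₁ + x₂), p1 (y₁ + y₂), N0 (x₁ + x₂), N0 (x₁ + y₂),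
      N0 (y₁ + x₂), N0 (y₁ + y₂)]
  rw [p0 _ z0, p0 _ z1, p0 _ z2, p0 _ c]
  have k1 := p1 (x₁ + x₂)
  have k2 := p1 (x₁ + y₂)
  have k3 := p1 (x₁ + z₂)
  have k4 := p1 (y₁ + x₂)
  have k5 := p1 (z₁ + x₂)
  have n1 := N0 (x₁ + x₂)
  have n2 := N0 (x₁ + y₂)
  have n3 := N0 (x₁ + z₂)
  have n4 := N0 (y₁ + x₂)
  have n5 := N0 (z₁ + x₂)
  rcases le_or_gt 1 (x₁ + z₂) with d | d
  · rcases le_or_gt 1 (y₁ + x₂) with e | e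
    · -- both triples are `(1, 0, 0)`
      have a2 := hN2 (y₁ + z₂) (by linarith)
      have a3 := hN2 (y₁ + y₂) (by linarith)
      have a4 := hN2 (z₁ + y₂) (by linarith)
      have a5 := hN2 (z₁ + z₂) (by linarith)
      linarith
    · have b1 := key (y₁ + x₂) (z₁ + y₂) (by linarith)
      have b2 := key (z₁ + x₂) (y₁ + y₂) (by linarith)
      have b3 := key (y₁ + z₂) (z₁ + z₂) (by linarith)
      rw [p0 _ e, p0 (z₁ + x₂) (by linarith)]
      linarith
  rw [p0 _ d]
  rcases le_or_gt 1 (z₁ + x₂) with e | e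
  · have b1 := key (x₁ + y₂) (y₁ + z₂) (by linarith)
    have b2 := key (x₁ + z₂) (y₁ + y₂) (by linarith)
    have b3 := key (z₁ + y₂) (z₁ + z₂) (by linarith)
    rw [p0 (x₁ + y₂) (by linarith)]
    linarith
  rw [p0 _ e]
  have b0 := N0 (y₁ + y₂)
  rcases le_or_gt 1 (x₁ + x₂) with g | g
  · have b1 := key (y₁ + y₂) (z₁ + z₂) (by linarith)
    have b2 := key (y₁ + z₂) (z₁ + y₂) (by linarith)
    rcases le_or_gt 1 (x₁ + y₂) with f | f
    · rcases le_or_gt 1 (y₁ + x₂) with f' | f'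
      · -- both triples are `(1 - y, y, 0)`
        have c1 := hN1 (y₁ + z₂) (by linarith)
        have c2 := hN1 (z₁ + y₂) (by linarith)
        have : 5 ≤ N (y₁ + y₂) + N (z₁ + z₂) + N (y₁ + z₂) + N (z₁ + y₂) := by
          have e1 : z₁ = 0 := by linarith
          have e2 : z₂ = 0 := by linarith
          have e3 : y₁ = y₂ := by linarith
          have e4 : y₂ < 1 / 2 := by linarith
          subst e1 e2 e3
          simp only [add_zero, zero_add]
          have b3 := hN2 0 le_rfl
          have b4 : 3 ≤ N 0 ∨ 2 ≤ N y₁ := by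
            by_cases g1 : x < 1 ∧ y < 1 ∧ z < 1
            · left
              rw [hN]; dsimp only
              rw [if_pos (by linarith), if_pos (by linarith), if_pos (by linarith)]
              norm_num
            · right
              rw [hN]; dsimp only
              split_ifs <;> first
                | (norm_num; done)
                | (exact absurd ⟨by linarith, by linarith, by linarith⟩ g1)
          have b5 := hN1 y₁ e4.le
          rcases b4 with b4 | b4 <;> linarith [N0 (y₁ + y₁)]
        linarith
      · rw [p0 _ f']; linarith
    · rw [p0 _ f]; linarith
  · rw [p0 _ g, p0 (x₁ + y₂) (by linarith), p0 (y₁ + x₂) (by linarith)]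
    linarith [N0 (y₁ + z₂), N0 (z₁ + y₂), N0 (z₁ + z₂)]

/-- The inequality obtained by averaging `local_inequality`. The hypothesis `hw` says that the
values of `w` are distributed as a mixture, with masses `Q j`, of sorted triples with sum at most
`1`. Expanding both sides over triples of indices `j`, `k`, `l` with masses `Q j * Q k * Q l`
reduces the claim to one instance of `local_inequality` for each of them. -/
lemma averaged_inequality {V J : Type*} [Fintype V] [Fintype J] (w : V → ℝ)
    (Q x y z : J → ℝ) (hQ : ∀ j, 0 ≤ Q j)
    (h1 : ∀ j, y j ≤ x j) (h2 : ∀ j, z j ≤ y j) (h3 : ∀ j, 0 ≤ z j)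
    (h4 : ∀ j, x j + y j + z j ≤ 1)
    (hw : ∀ g : ℝ → ℝ, ∑ v, g (w v) = ∑ j, Q j * (g (x j) + g (y j) + g (z j))) :
    (Fintype.card V : ℝ) * #{p : V × V | 1 ≤ w p.1 + w p.2} ≤
      2 * #{p : V × V × V | w p.1 + w p.2.1 + w p.2.2 < 1} := by
  have hV : (Fintype.card V : ℝ) = 3 * ∑ j, Q j := by
    have := hw (fun _ => 1)
    simp only [sum_const, card_univ, nsmul_eq_mul, mul_one] at this
    rw [this, mul_sum]
    exact sum_congr rfl fun j _ => by ring
  set p : ℝ → ℝ := fun u => if 1 ≤ u then 1 else 0 with hp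
  set S : J → (ℝ → ℝ) → ℝ := fun j g => g (x j) + g (y j) + g (z j) with hS
  have e2 : (#{p : V × V | 1 ≤ w p.1 + w p.2} : ℝ) =
      ∑ j, ∑ k, Q j * Q k * S j (fun a => S k (fun b => p (a + b))) := by
    rw [Finset.card_filter, Nat.cast_sum, Fintype.sum_prod_type]
    have : ∀ u v : V, (((if 1 ≤ w u + w v then 1 else 0 : ℕ)) : ℝ) = p (w u + w v) := by
      intro u v; simp only [hp]; split_ifs <;> simp
    simp only [this]
    rw [hw (fun a => ∑ v, p (a + w v))]
    refine sum_congr rfl fun j _ => ?_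
    have := fun a => hw (fun b => p (a + b))
    simp only [this, hS, ← sum_add_distrib, mul_sum]
    exact sum_congr rfl fun k _ => by ring
  have e3 : (#{p : V × V × V | w p.1 + w p.2.1 + w p.2.2 < 1} : ℝ) =
      ∑ j, ∑ k, ∑ l, Q j * Q k * Q l * S j (fun a => S k (fun b => S l (fun c =>
        if a + b + c < 1 then 1 else 0))) := by
    rw [Finset.card_filter, Nat.cast_sum, Fintype.sum_prod_type]
    simp only [Fintype.sum_prod_type]
    push_cast
    rw [hw (fun a => ∑ v, ∑ u, if a + w v + w u < 1 then 1 else 0)]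
    refine sum_congr rfl fun j _ => ?_
    have h5 := fun a => hw (fun b => ∑ u, if a + b + w u < 1 then (1 : ℝ) else 0)
    simp only [h5]
    have h6 := fun a b => hw (fun c => if a + b + c < 1 then (1 : ℝ) else 0)
    simp only [h6, hS, ← sum_add_distrib, mul_sum]
    exact sum_congr rfl fun k _ => sum_congr rfl fun l _ => by ring
  have e4 : 3 * (∑ j, Q j) * ∑ j, ∑ k, Q j * Q k * S j (fun a => S k (fun b => p (a + b))) =
      ∑ j, ∑ k, ∑ l, Q j * Q k * Q l * (3 * S j (fun a => S k (fun b => p (a + b)))) := by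
    simp only [mul_sum, sum_mul]
    exact sum_congr rfl fun j _ => sum_congr rfl fun k _ => sum_congr rfl fun l _ => by ring
  rw [hV, e2, e3, e4]
  simp only [mul_sum]
  refine sum_le_sum fun j _ => sum_le_sum fun k _ => sum_le_sum fun l _ => ?_
  rw [mul_left_comm 2]
  refine mul_le_mul_of_nonneg_left ?_ (mul_nonneg (mul_nonneg (hQ j) (hQ k)) (hQ l))
  have := local_inequality (h1 j) (h2 j) (h3 j) (h4 j) (h1 k) (h2 k) (h3 k) (h4 k)
    (((h3 l).trans (h2 l)).trans (h1 l)) ((h3 l).trans (h2 l)) (h3 l) (h4 l) p hp _ rfl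
  simpa only [hS] using this

/-! ### Fractional covers and fractional matchings -/

/-- Strong linear programming duality for fractional matchings: a fractional vertex cover `w` and a
fractional matching `y` satisfying the complementary slackness conditions. The matching is a probability vector on `R`
whose maximal load `μ` on a vertex is least possible, divided by `μ`; the cover is a multiple of a
functional that separates the possible loads from the vectors with all entries below `μ`. -/
lemma exists_cover_matching {V : Type*} [Fintype V] [DecidableEq V] {R : Finset (Finset V)}
    (hR : R.Nonempty) (hne : ∀ e ∈ R, e.Nonempty) :
    ∃ (w : V → ℝ) (y : R → ℝ), (∀ v, 0 ≤ w v) ∧ (∀ e ∈ R, 1 ≤ ∑ v ∈ e, w v) ∧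
      (∀ e, 0 ≤ y e) ∧ (∀ v, ∑ e, (if v ∈ e.1 then y e else 0) ≤ 1) ∧
      (∀ v, w v ≠ 0 → ∑ e, (if v ∈ e.1 then y e else 0) = 1) ∧
      (∀ e, y e ≠ 0 → ∑ v ∈ e.1, w v = 1) := by
  classical
  obtain ⟨e₀, he₀⟩ := hR
  obtain ⟨v₀, hv₀⟩ := hne e₀ he₀
  have : Nonempty V := ⟨v₀⟩
  let load : (R → ℝ) →ₗ[ℝ] (V → ℝ) :=
    { toFun := fun l v => ∑ e, (if v ∈ e.1 then l e else 0)
      map_add' := fun a b => by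
        ext v; simp only [Pi.add_apply, ← sum_add_distrib]
        exact sum_congr rfl fun e _ => by split_ifs <;> simp
      map_smul' := fun c a => by
        ext v; simp only [Pi.smul_apply, smul_eq_mul, RingHom.id_apply, mul_sum]
        exact sum_congr rfl fun e _ => by split_ifs <;> simp }
  have load_apply : ∀ l v, load l v = ∑ e, (if v ∈ e.1 then l e else 0) := fun _ _ => rfl
  have hcont : Continuous fun l => univ.sup' univ_nonempty (fun v => load l v) := by
    refine Continuous.finset_sup'_apply _ fun v _ => ?_
    exact (continuous_apply v).comp load.continuous_of_finiteDimensional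
  have hΔ : (stdSimplex ℝ R).Nonempty := ⟨_, single_mem_stdSimplex ℝ ⟨e₀, he₀⟩⟩
  obtain ⟨l, hl, hmin⟩ := (isCompact_stdSimplex ℝ R).exists_isMinOn hΔ hcont.continuousOn
  set μ : ℝ := univ.sup' univ_nonempty (fun v => load l v) with hμ
  have hloadle : ∀ v, load l v ≤ μ := fun v => le_sup' (fun v => load l v) (mem_univ v)
  obtain ⟨hl0, hl1⟩ := hl
  have hμ0 : 0 < μ := by
    obtain ⟨e, -, he⟩ : ∃ e ∈ (univ : Finset R), 0 < l e := by
      by_contra! h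
      have := sum_nonpos h
      linarith
    obtain ⟨v, hv⟩ := hne e.1 e.2
    refine lt_of_lt_of_le ?_ (hloadle v)
    rw [load_apply]
    refine sum_pos' (fun e _ => ?_) ⟨e, mem_univ _, by rw [if_pos hv]; exact he⟩
    split_ifs
    exacts [hl0 e, le_rfl]
  -- Separate the loads of probability vectors from the vectors with all entries below `μ`.
  obtain ⟨f, u, hfU, hfK⟩ := geometric_hahn_banach_open (E := V → ℝ)
    (s := Set.pi Set.univ fun _ => Set.Iio μ) (t := load '' stdSimplex ℝ R)
    (convex_pi fun _ _ => convex_Iio μ) (isOpen_set_pi Set.finite_univ fun _ _ => isOpen_Iio)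
    ((convex_stdSimplex ℝ R).linear_image load) (by
      rw [Set.disjoint_left]
      rintro x hx ⟨l', hl', rfl⟩
      have h1 : μ ≤ univ.sup' univ_nonempty (fun v => load l' v) := hmin hl'
      refine absurd h1 (not_le.2 ((sup'_lt_iff _).2 fun v _ => ?_))
      exact hx v (Set.mem_univ v))
  set w : V → ℝ := fun v => f (Pi.single v 1) with hw
  have hf : ∀ x, f x = ∑ v, x v * w v := fun x => by
    have h1 : x = ∑ v, x v • (Pi.single v 1 : V → ℝ) := by
      ext v'; simp [Finset.sum_apply, Pi.single_apply]
    conv_lhs => rw [h1, map_sum]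
    simp only [map_smul, smul_eq_mul, hw]
  have hU : ∀ x : V → ℝ, (∀ v, x v < μ) → ∑ v, x v * w v < u := fun x hx => by
    rw [← hf]; exact hfU x fun v _ => hx v
  have hw0 : ∀ v, 0 ≤ w v := by
    intro v
    by_contra! hneg
    have h1 := hU (fun _ => μ - 1) (fun _ => by linarith)
    set A := ∑ v, (μ - 1) * w v
    have ht : 0 ≤ (u - A) / (-w v) := div_nonneg (by linarith) (by linarith)
    have h2 := hU ((fun _ => μ - 1) - ((u - A) / (-w v)) • Pi.single v 1) (fun v' => by
      rcases eq_or_ne v' v with rfl | hne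
      · simp only [Pi.sub_apply, Pi.smul_apply, Pi.single_eq_same, smul_eq_mul]; linarith
      · simp [Pi.single_eq_of_ne hne])
    simp only [Pi.sub_apply, Pi.smul_apply, smul_eq_mul, sub_mul, sum_sub_distrib] at h2
    have h3 : ∑ x, (u - A) / (-w v) * (Pi.single v (1 : ℝ) : V → ℝ) x * w x
        = (u - A) / (-w v) * w v := by
      rw [sum_eq_single v]
      · simp
      · intro b _ hb; simp [Pi.single_eq_of_ne hb]
      · simp
    rw [h3] at h2
    have h4 : (u - A) / (-w v) * w v = -(u - A) := by field_simp [hneg.ne]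
    have h5 : ∑ x, (μ * w x - 1 * w x) = A := by
      simp only [A, sub_mul]
    simp only [← sum_sub_distrib] at h2
    rw [h5, h4] at h2
    linarith
  set W := ∑ v, w v with hWdef
  have hW0 : 0 ≤ W := sum_nonneg fun v _ => hw0 v
  have hconst : ∀ ε > 0, (μ - ε) * W < u := fun ε hε => by
    have := hU (fun _ => μ - ε) (fun _ => by linarith)
    rwa [← mul_sum] at this
  have hμW : μ * W ≤ u := by
    refine le_of_forall_pos_lt_add fun δ hδ => ?_
    have h1 := hconst (δ / (W + 1)) (by positivity)
    have h2 : δ / (W + 1) * W ≤ δ := by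
      rw [div_mul_eq_mul_div, div_le_iff₀ (by positivity)]; nlinarith
    nlinarith
  have hK : ∀ l' ∈ stdSimplex ℝ R, u ≤ ∑ v, load l' v * w v := fun l' hl' => by
    rw [← hf]; exact hfK _ ⟨l', hl', rfl⟩
  have hfl : ∑ v, load l v * w v ≤ μ * W := by
    rw [mul_sum]; exact sum_le_sum fun v _ => mul_le_mul_of_nonneg_right (hloadle v) (hw0 v)
  have hul := hK l ⟨hl0, hl1⟩
  have hu : u = μ * W := le_antisymm (hul.trans hfl) hμW
  have hu0 : 0 < u := by
    rcases hW0.eq_or_lt with h | h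
    · have := hconst 1 one_pos
      rw [← h] at this; linarith
    · rw [hu]; positivity
  have hedge : ∀ e ∈ R, u ≤ ∑ v ∈ e, w v := fun e he => by
    have h1 := hK _ (single_mem_stdSimplex ℝ (⟨e, he⟩ : R))
    have h2 : ∀ v, load (Pi.single (⟨e, he⟩ : R) 1) v = if v ∈ e then 1 else 0 := by
      intro v
      rw [load_apply, sum_eq_single (⟨e, he⟩ : R)]
      · simp
      · intro b _ hb; simp [Pi.single_eq_of_ne hb]
      · simp
    simpa only [h2, ite_mul, one_mul, zero_mul, sum_ite_mem, univ_inter] using h1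
  have hsl1 : ∀ v, w v ≠ 0 → load l v = μ := by
    have h1 : ∑ v, (μ - load l v) * w v = 0 := by
      simp only [sub_mul, sum_sub_distrib, ← mul_sum]; linarith
    rw [sum_eq_zero_iff_of_nonneg fun v _ =>
      mul_nonneg (sub_nonneg.2 (hloadle v)) (hw0 v)] at h1
    intro v hv
    have := (mul_eq_zero.1 (h1 v (mem_univ v))).resolve_right hv
    linarith
  have hswap : ∑ v, load l v * w v = ∑ e, l e * ∑ v ∈ e.1, w v := by
    simp only [load_apply, sum_mul, mul_sum]
    rw [sum_comm]
    refine sum_congr rfl fun e _ => ?_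
    simp only [ite_mul, zero_mul, sum_ite_mem, univ_inter]
  have hsl2 : ∀ e, l e ≠ 0 → ∑ v ∈ e.1, w v = u := by
    have h1 : ∑ e, l e * ((∑ v ∈ e.1, w v) - u) = 0 := by
      simp only [mul_sub, sum_sub_distrib, ← sum_mul, ← hswap]
      rw [hl1]; linarith
    rw [sum_eq_zero_iff_of_nonneg fun e _ =>
      mul_nonneg (hl0 e) (sub_nonneg.2 (hedge e.1 e.2))] at h1
    intro e he
    have := (mul_eq_zero.1 (h1 e (mem_univ e))).resolve_left he
    linarith
  have hdiv : ∀ v, ∑ e : R, (if v ∈ e.1 then l e / μ else 0) = load l v / μ := fun v => by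
    rw [load_apply, sum_div]
    exact sum_congr rfl fun e _ => by split_ifs <;> simp
  refine ⟨fun v => w v / u, fun e => l e / μ, fun v => div_nonneg (hw0 v) hu0.le, fun e he => ?_,
    fun e => div_nonneg (hl0 e) hμ0.le, fun v => ?_, fun v hv => ?_, fun e he => ?_⟩
  · rw [← sum_div, le_div_iff₀ hu0, one_mul]; exact hedge e he
  · rw [hdiv, div_le_one hμ0]; exact hloadle v
  · rw [hdiv, div_eq_one_iff_eq hμ0.ne']
    exact hsl1 v fun h => hv (by simp [h])
  · rw [← sum_div, div_eq_one_iff_eq hu0.ne']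
    exact hsl2 e fun h => he (by simp [h])

lemma exists_sorted (a b c : ℝ) (ha : 0 ≤ a) (hb : 0 ≤ b) (hc : 0 ≤ c) (h : a + b + c ≤ 1) :
    ∃ t : ℝ × ℝ × ℝ, t.2.1 ≤ t.1 ∧ t.2.2 ≤ t.2.1 ∧ 0 ≤ t.2.2 ∧ t.1 + t.2.1 + t.2.2 ≤ 1 ∧
      ∀ g : ℝ → ℝ, g a + g b + g c = g t.1 + g t.2.1 + g t.2.2 := by
  rcases le_total a b with h1 | h1 <;> rcases le_total b c with h2 | h2 <;>
    rcases le_total a c with h3 | h3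
  · exact ⟨(c, b, a), h2, h1, ha, by dsimp only; linarith, fun g => by dsimp only; ring⟩
  · exact ⟨(c, b, a), h2, h1, ha, by dsimp only; linarith, fun g => by dsimp only; ring⟩
  · exact ⟨(b, c, a), h2, h3, ha, by dsimp only; linarith, fun g => by dsimp only; ring⟩
  · exact ⟨(b, a, c), h1, h3, hc, by dsimp only; linarith, fun g => by dsimp only; ring⟩
  · exact ⟨(c, a, b), h3, h1, hb, by dsimp only; linarith, fun g => by dsimp only; ring⟩
  · exact ⟨(a, c, b), h3, h2, hb, by dsimp only; linarith, fun g => by dsimp only; ring⟩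
  · exact ⟨(a, b, c), h1, h2, hc, h, fun g => rfl⟩
  · exact ⟨(a, b, c), h1, h2, hc, h, fun g => rfl⟩

/-- If every fractional matching of a family `R` of pairs and triples has total weight at most
`|V| / 3`, then there is a fractional cover `w` of `R` for which the number of triples of
weight below `1` is at least `|V| / 2` times the number of pairs of weight at least `1`. -/
lemma exists_weight {V : Type*} [Fintype V] [DecidableEq V] {R : Finset (Finset V)}
    (hR : ∀ e ∈ R, #e = 2 ∨ #e = 3)
    (hfrac : ∀ y : R → ℝ, (∀ e, 0 ≤ y e) → (∀ v, ∑ e, (if v ∈ e.1 then y e else 0) ≤ 1) →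
      ∑ e, y e ≤ Fintype.card V / 3) :
    ∃ w : V → ℝ, (∀ e ∈ R, 1 ≤ ∑ v ∈ e, w v) ∧
      (Fintype.card V : ℝ) * #{p : V × V | 1 ≤ w p.1 + w p.2} ≤
        2 * #{p : V × V × V | w p.1 + w p.2.1 + w p.2.2 < 1} := by
  rcases R.eq_empty_or_nonempty with rfl | hne
  · refine ⟨fun _ => 0, by simp, ?_⟩
    rw [filter_false_of_mem (by intro p _; norm_num)]
    simp; positivity
  obtain ⟨w, y, hw0, hw1, hy0, hy1, hs1, hs2⟩ := exists_cover_matching hne fun e he => by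
    rw [← card_pos]; rcases hR e he with h | h <;> omega
  refine ⟨w, hw1, ?_⟩
  have htrip : ∀ e : R, ∃ t : ℝ × ℝ × ℝ, t.2.1 ≤ t.1 ∧ t.2.2 ≤ t.2.1 ∧ 0 ≤ t.2.2 ∧
      t.1 + t.2.1 + t.2.2 ≤ 1 ∧ ∀ g : ℝ → ℝ,
        y e * (∑ v ∈ e.1, g (w v) + (3 - (#e.1 : ℝ)) * g 0) =
          y e * (g t.1 + g t.2.1 + g t.2.2) := by
    intro e
    by_cases he : y e = 0
    · exact ⟨(0, 0, 0), le_rfl, le_rfl, le_rfl, by norm_num, fun g => by rw [he]; ring⟩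
    have h1 := hs2 e he
    rcases hR e.1 e.2 with h | h
    · obtain ⟨a, b, hab, hE⟩ := card_eq_two.1 h
      rw [hE, sum_pair hab] at h1
      obtain ⟨t, t1, t2, t3, t4, t5⟩ := exists_sorted (w a) (w b) 0 (hw0 a) (hw0 b) le_rfl
        (by linarith)
      refine ⟨t, t1, t2, t3, t4, fun g => ?_⟩
      rw [← t5 g, h, hE, sum_pair hab]; push_cast; ring
    · obtain ⟨a, b, c, hab, hac, hbc, hE⟩ := card_eq_three.1 h
      have hsum : ∀ g : V → ℝ, ∑ v ∈ e.1, g v = g a + g b + g c := fun g => by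
        rw [hE, sum_insert (by simp [hab, hac]), sum_pair hbc]; ring
      rw [hsum] at h1
      obtain ⟨t, t1, t2, t3, t4, t5⟩ := exists_sorted (w a) (w b) (w c) (hw0 a) (hw0 b) (hw0 c)
        (by linarith)
      refine ⟨t, t1, t2, t3, t4, fun g => ?_⟩
      rw [← t5 g, h, hsum]; push_cast; ring
  choose t t1 t2 t3 t4 t5 using htrip
  -- An edge `e` of mass `y e` contributes the weights of its vertices, padded by `0` if `e` is
  -- a pair. The load missing at the vertices of weight `0` goes to the triple `(0, 0, 0)`.
  refine averaged_inequality (J := Option R) w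
    (fun j => j.elim (Fintype.card V / 3 - ∑ e, y e) y)
    (fun j => j.elim 0 fun e => (t e).1) (fun j => j.elim 0 fun e => (t e).2.1)
    (fun j => j.elim 0 fun e => (t e).2.2) ?_ ?_ ?_ ?_ ?_ fun g => ?_
  · rintro (_ | e)
    · exact sub_nonneg.2 (hfrac y hy0 hy1)
    · exact hy0 e
  · rintro (_ | e)
    exacts [le_rfl, t1 e]
  · rintro (_ | e)
    exacts [le_rfl, t2 e]
  · rintro (_ | e)
    exacts [le_rfl, t3 e]
  · rintro (_ | e)
    exacts [by simp, t4 e]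
  · rw [Fintype.sum_option]
    simp only [Option.elim_none, Option.elim_some, ← t5]
    have h1 : ∀ v, g (w v) = (∑ e : R, (if v ∈ e.1 then y e else 0)) * g (w v)
        + (1 - ∑ e : R, (if v ∈ e.1 then y e else 0)) * g 0 := by
      intro v
      by_cases hv : w v = 0
      · rw [hv]; ring
      · rw [hs1 v hv]; ring
    rw [sum_congr rfl fun v _ => h1 v, sum_add_distrib]
    have h2 : ∀ G : V → ℝ, ∑ v, (∑ e : R, (if v ∈ e.1 then y e else 0)) * G v =
        ∑ e : R, y e * ∑ v ∈ e.1, G v := by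
      intro G
      simp only [sum_mul, mul_sum]
      rw [sum_comm]
      exact sum_congr rfl fun e _ => by simp only [ite_mul, zero_mul, sum_ite_mem, univ_inter]
    have h3 := h2 fun _ => 1
    simp only [mul_one, sum_const, nsmul_eq_mul] at h3
    rw [h2, ← sum_mul, sum_sub_distrib, h3]
    simp only [sum_const, card_univ, nsmul_eq_mul, mul_one, mul_add, sum_add_distrib, ← mul_assoc,
      mul_sub, sub_mul, sum_sub_distrib, ← sum_mul]
    ring

/-! ### Shifted families and matchings -/

/-- A family is shifted if replacing an element of a member by a smaller non-element gives
a member again. -/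
def IsShifted (F : Finset (Finset ℕ)) : Prop :=
  ∀ e ∈ F, ∀ i j, i < j → j ∈ e → i ∉ e → insert i (e.erase j) ∈ F

/-- No more than `s` members of the family are pairwise disjoint. -/
def MatchingLE {α : Type*} (F : Finset (Finset α)) (s : ℕ) : Prop :=
  ∀ M ⊆ F, (M : Set (Finset α)).PairwiseDisjoint id → #M ≤ s

lemma MatchingLE.mono {α : Type*} {F G : Finset (Finset α)} {s : ℕ} (hG : MatchingLE G s)
    (h : F ⊆ G) : MatchingLE F s := fun M hM hd => hG M (hM.trans h) hd

lemma MatchingLE.card_le {α : Type*} {F : Finset (Finset α)} {s : ℕ} (hF : MatchingLE F s)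
    {ι : Type*} [Fintype ι] (f : ι → Finset α) (hf : ∀ i, f i ∈ F) (hne : ∀ i, (f i).Nonempty)
    (hd : ∀ i j, i ≠ j → Disjoint (f i) (f j)) : Fintype.card ι ≤ s := by
  classical
  have hinj : Function.Injective f := by
    intro i j hij
    by_contra h
    have := hd i j h
    rw [hij, disjoint_self] at this
    exact (hne j).ne_empty this
  rw [← card_univ, ← card_image_of_injective univ hinj]
  refine hF _ (by intro e he; obtain ⟨i, -, rfl⟩ := mem_image.1 he; exact hf i) ?_
  intro a ha b hb hab
  simp only [coe_image, coe_univ, Set.image_univ, Set.mem_range] at ha hb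
  obtain ⟨i, rfl⟩ := ha
  obtain ⟨j, rfl⟩ := hb
  exact hd i j fun h => hab (by rw [h])

/-- A shifted family contains every image of a member under an injection that does not increase
any element. -/
lemma IsShifted.image_mem {F : Finset (Finset ℕ)} (hF : IsShifted F) :
    ∀ {e : Finset ℕ}, e ∈ F → ∀ {f : ℕ → ℕ}, Set.InjOn f e → (∀ x ∈ e, f x ≤ x) →
      e.image f ∈ F := by
  suffices h : ∀ k, ∀ e ∈ F, ∀ f : ℕ → ℕ, Set.InjOn f e → (∀ x ∈ e, f x ≤ x) →
      #{x ∈ e | f x ≠ x} = k → e.image f ∈ F from fun {e} he {f} hi hle => h _ _ he _ hi hle rfl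
  intro k
  induction k with
  | zero =>
    intro e he f hi hle h0
    rw [card_eq_zero, filter_eq_empty_iff] at h0
    have : e.image f = e.image id := image_congr fun x hx => by
      have := h0 hx; simpa using this
    rwa [this, image_id]
  | succ k ih =>
    intro e he f hi hle hk
    have hne : {x ∈ e | f x ≠ x}.Nonempty := card_pos.1 (by omega)
    -- Move the least element `x` that is not fixed; the target is not an element of `e`.
    set x := {x ∈ e | f x ≠ x}.min' hne with hx
    obtain ⟨hxe, hfx⟩ := mem_filter.1 (min'_mem _ hne)
    rw [← hx] at hxe hfx
    have hlt : f x < x := lt_of_le_of_ne (hle x hxe) hfx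
    have hnot : f x ∉ e := by
      intro hmem
      by_cases h : f (f x) = f x
      · exact hfx (hi hmem hxe h)
      · exact absurd (min'_le _ _ (mem_filter.2 ⟨hmem, h⟩)) (not_le.2 (hx ▸ hlt))
    have he' := hF e he (f x) x hlt hxe hnot
    set f' : ℕ → ℕ := fun z => if z = f x then f x else f z with hf'
    have hf'1 : f' (f x) = f x := by simp [hf']
    have hf'2 : ∀ z ∈ e, f' z = f z := by
      intro z hz
      have : z ≠ f x := fun h => hnot (h ▸ hz)
      simp [hf', this]
    have himg : (insert (f x) (e.erase x)).image f' = e.image f := by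
      rw [image_insert, hf'1, image_congr (g := f) fun z hz => hf'2 z (mem_of_mem_erase hz),
        ← image_insert, insert_erase hxe]
    rw [← himg]
    refine ih _ he' f' ?_ ?_ ?_
    · intro a ha b hb hab
      simp only [coe_insert, coe_erase, Set.mem_insert_iff, Set.mem_sdiff, mem_coe,
        Set.mem_singleton_iff] at ha hb
      rcases ha with rfl | ha <;> rcases hb with rfl | hb
      · rfl
      · rw [hf'1, hf'2 b hb.1] at hab
        exact absurd (hi hxe hb.1 hab).symm hb.2
      · rw [hf'1, hf'2 a ha.1] at hab
        exact absurd (hi ha.1 hxe hab) ha.2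
      · rw [hf'2 a ha.1, hf'2 b hb.1] at hab
        exact hi ha.1 hb.1 hab
    · intro z hz
      rcases mem_insert.1 hz with rfl | hz
      · exact hf'1.le
      · rw [hf'2 z (mem_of_mem_erase hz)]; exact hle z (mem_of_mem_erase hz)
    · have : {z ∈ insert (f x) (e.erase x) | f' z ≠ z} = {z ∈ e | f z ≠ z}.erase x := by
        ext z
        simp only [mem_filter, mem_insert, mem_erase]
        constructor
        · rintro ⟨rfl | ⟨h1, h2⟩, h3⟩
          · exact absurd hf'1 h3
          · rw [hf'2 z h2] at h3; exact ⟨h1, h2, h3⟩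
        · rintro ⟨h1, h2, h3⟩
          exact ⟨Or.inr ⟨h1, h2⟩, by rwa [hf'2 z h2]⟩
      have hxm : x ∈ {z ∈ e | f z ≠ z} := mem_filter.2 ⟨hxe, hfx⟩
      rw [this, card_erase_of_mem hxm, hk]; rfl

/-- In a shifted family, a matching can be moved onto an initial segment: every vertex is replaced
by its rank among the vertices of the matching. -/
lemma IsShifted.exists_initial {F : Finset (Finset ℕ)} (hF : IsShifted F) {k : ℕ}
    (hk : ∀ e ∈ F, #e = k) (hk0 : 0 < k) {M : Finset (Finset ℕ)} (hM : M ⊆ F)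
    (hd : (M : Set (Finset ℕ)).PairwiseDisjoint id) :
    ∃ M' ⊆ F, (M' : Set (Finset ℕ)).PairwiseDisjoint id ∧ #M' = #M ∧
      ∀ e ∈ M', e ⊆ range (k * #M) := by
  set U := M.biUnion id with hU
  have hUc : #U = k * #M := by
    rw [hU, card_biUnion hd, sum_congr rfl fun e he => show #(id e) = k from hk e (hM he)]
    simp [mul_comm]
  set f : ℕ → ℕ := fun u => #{x ∈ U | x < u} with hf
  have hmono : ∀ u ∈ U, ∀ v, u < v → f u < f v := by
    intro u hu v huv
    refine card_lt_card ⟨fun x hx => ?_, fun h => ?_⟩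
    · rw [mem_filter] at hx ⊢; exact ⟨hx.1, hx.2.trans huv⟩
    · have := h (mem_filter.2 ⟨hu, huv⟩); simp at this
  have hinj : Set.InjOn f U := by
    intro u hu v hv huv
    rcases lt_trichotomy u v with h | h | h
    · exact absurd huv (hmono u hu v h).ne
    · exact h
    · exact absurd huv (hmono v hv u h).ne'
  have hle : ∀ u, f u ≤ u := fun u => by
    calc f u ≤ #(range u) := card_le_card fun x hx => by
          rw [mem_filter] at hx; exact mem_range.2 hx.2
      _ = u := card_range u
  have hlt : ∀ u ∈ U, f u < k * #M := fun u hu => by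
    rw [← hUc]
    exact card_lt_card ⟨filter_subset _ _, fun h => by simpa using h hu⟩
  have hsub : ∀ e ∈ M, e ⊆ U := fun e he => subset_biUnion_of_mem id he
  have hdis : ∀ a ∈ M, ∀ b ∈ M, a ≠ b → Disjoint (a.image f) (b.image f) := by
    intro a ha b hb hab
    have h : Disjoint a b := hd ha hb hab
    rw [disjoint_left] at h ⊢
    intro x hxa hxb
    obtain ⟨y, hy, rfl⟩ := mem_image.1 hxa
    obtain ⟨z, hz, hzy⟩ := mem_image.1 hxb
    have := hinj (hsub b hb hz) (hsub a ha hy) hzy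
    subst this
    exact h hy hz
  have hMinj : Set.InjOn (fun e : Finset ℕ => e.image f) M := by
    intro a ha b hb hab
    by_contra hne
    have h := hdis a ha b hb hne
    simp only at hab
    rw [hab, disjoint_self, bot_eq_empty, image_eq_empty] at h
    have := hk b (hM hb)
    rw [h, card_empty] at this
    omega
  refine ⟨M.image fun e => e.image f, ?_, ?_, card_image_of_injOn hMinj, ?_⟩
  · intro e he
    obtain ⟨a, ha, rfl⟩ := mem_image.1 he
    exact hF.image_mem (hM ha) (hinj.mono (hsub a ha)) fun x _ => hle x
  · intro a ha b hb hab
    simp only [coe_image, Set.mem_image, mem_coe] at ha hb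
    obtain ⟨a, ha, rfl⟩ := ha
    obtain ⟨b, hb, rfl⟩ := hb
    exact hdis a ha b hb fun h => hab (by rw [h])
  · intro e he x hx
    obtain ⟨a, ha, rfl⟩ := mem_image.1 he
    obtain ⟨y, hy, rfl⟩ := mem_image.1 hx
    exact mem_range.2 (hlt y (hsub a ha hy))

/-! ### Averaging over permutations -/

lemma exists_perm_map_eq {α : Type*} {e e' : Finset α} (h : #e = #e') :
    ∃ π : Equiv.Perm α, e.map π.toEmbedding = e' := by
  obtain ⟨π, hπ⟩ := (Equiv.Perm.isMultiplyPretransitive α #e).exists_smul_eq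
    (e.equivFin.symm.toEmbedding.trans (Function.Embedding.subtype _))
    ((e'.equivFinOfCardEq h.symm).symm.toEmbedding.trans (Function.Embedding.subtype _))
  refine ⟨π, eq_of_subset_of_card_le (fun x hx => ?_) (by rw [card_map, h])⟩
  obtain ⟨y, hy, rfl⟩ := mem_map.1 hx
  have := DFunLike.congr_fun hπ (e.equivFin ⟨y, hy⟩)
  simp only [Function.Embedding.smul_apply, Function.Embedding.trans_apply,
    Equiv.coe_toEmbedding, Equiv.symm_apply_apply, Function.Embedding.subtype_apply,
    Equiv.Perm.smul_def] at this
  exact this ▸ Subtype.prop _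

/-- Averaging over all placements of `q` disjoint triples: a family of triples without `k + 1`
disjoint members has density at most `k / q`. -/
lemma MatchingLE.mul_card_le {α : Type*} [Fintype α] [DecidableEq α] {H : Finset (Finset α)}
    {k q : ℕ} (hH : MatchingLE H k) (h3 : ∀ e ∈ H, #e = 3) (hq : 3 * q ≤ Fintype.card α) :
    q * #H ≤ k * (Fintype.card α).choose 3 := by
  -- `q` disjoint triples
  obtain ⟨T, hT3, hTd⟩ : ∃ T : Fin q → Finset α, (∀ i, #(T i) = 3) ∧
      ∀ i j, i ≠ j → Disjoint (T i) (T j) := by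
    have hc : Fintype.card (Fin q × Fin 3) ≤ Fintype.card α := by simp; omega
    obtain ⟨g⟩ := Function.Embedding.nonempty_of_card_le hc
    refine ⟨fun i => univ.map ((Function.Embedding.sectR i (Fin 3)).trans g), fun i => by simp,
      fun i j hij => ?_⟩
    rw [disjoint_left]
    intro x hx hx'
    simp only [mem_map, mem_univ, true_and, Function.Embedding.trans_apply,
      Function.Embedding.sectR_apply] at hx hx'
    obtain ⟨a, rfl⟩ := hx
    obtain ⟨b, hb⟩ := hx'
    have := g.injective hb
    simp only [Prod.mk.injEq] at this
    exact hij this.1.symm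
  -- All triples are equally likely images of a fixed triple under a random permutation.
  have hfib : ∀ A B C : Finset α, #A = 3 → #B = 3 → #C = 3 →
      #{σ : Equiv.Perm α | A.map σ.toEmbedding = B} =
        #{σ : Equiv.Perm α | A.map σ.toEmbedding = C} := by
    intro A B C hA hB hC
    obtain ⟨π, hπ⟩ := exists_perm_map_eq (hB.trans hC.symm)
    refine card_bij (fun σ _ => π * σ) ?_ ?_ ?_
    · intro σ hσ
      simp only [mem_filter, mem_univ, true_and] at hσ ⊢
      rw [← hπ, ← hσ, map_map]; rfl
    · intro σ _ τ _ h; exact mul_left_cancel h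
    · intro σ hσ
      simp only [mem_filter, mem_univ, true_and] at hσ
      refine ⟨π⁻¹ * σ, ?_, by simp⟩
      simp only [mem_filter, mem_univ, true_and]
      have : B = C.map (π⁻¹).toEmbedding := by
        rw [← hπ, map_map]; ext; simp
      rw [this, ← hσ, map_map]; rfl
  have hcount : ∀ A : Finset α, #A = 3 → ∀ P ⊆ powersetCard 3 (univ : Finset α),
      #{σ : Equiv.Perm α | A.map σ.toEmbedding ∈ P} * (Fintype.card α).choose 3 =
        (Fintype.card α).factorial * #P := by
    intro A hA
    have h1 : ∀ P ⊆ powersetCard 3 (univ : Finset α),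
        #{σ : Equiv.Perm α | A.map σ.toEmbedding ∈ P} =
          #P * #{σ : Equiv.Perm α | A.map σ.toEmbedding = A} := by
      intro P hP
      rw [card_eq_sum_card_fiberwise (t := P) (f := fun σ : Equiv.Perm α => A.map σ.toEmbedding)
        (fun σ hσ => by simpa using hσ), ← smul_eq_mul, ← sum_const]
      refine sum_congr rfl fun B hB => ?_
      rw [filter_filter, ← hfib A B A hA (mem_powersetCard.1 (hP hB)).2 hA]
      congr 1
      ext σ
      simp only [mem_filter, mem_univ, true_and]
      exact ⟨fun h => h.2, fun h => ⟨h ▸ hB, h⟩⟩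
    intro P hP
    have h2 := h1 _ (subset_refl _)
    rw [filter_true_of_mem (by intro σ _; simp [mem_powersetCard, hA]), card_univ,
      Fintype.card_perm, card_powersetCard, card_univ] at h2
    rw [h1 P hP, h2]; ring
  have hHP : H ⊆ powersetCard 3 (univ : Finset α) := fun e he =>
    mem_powersetCard.2 ⟨subset_univ _, h3 e he⟩
  have hsum : ∑ i : Fin q, #{σ : Equiv.Perm α | (T i).map σ.toEmbedding ∈ H} ≤
      k * (Fintype.card α).factorial := by
    have : ∑ i : Fin q, #{σ : Equiv.Perm α | (T i).map σ.toEmbedding ∈ H} =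
        ∑ σ : Equiv.Perm α, #{i : Fin q | (T i).map σ.toEmbedding ∈ H} := by
      simp only [card_filter]; exact sum_comm
    rw [this, mul_comm, ← Fintype.card_perm, ← card_univ, ← smul_eq_mul, ← sum_const]
    refine sum_le_sum fun σ _ => ?_
    rw [← Fintype.card_coe]
    refine hH.card_le (fun i => (T i.1).map σ.toEmbedding) (fun i => ?_) (fun i => ?_)
      fun i j hij => ?_
    · exact (mem_filter.1 i.2).2
    · rw [← card_pos, card_map, hT3]; norm_num
    · exact (disjoint_map _).2 (hTd _ _ fun h => hij (Subtype.ext h))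
  have h1 := Nat.mul_le_mul_right ((Fintype.card α).choose 3) hsum
  rw [sum_mul, sum_congr rfl fun i _ => hcount (T i) (hT3 i) H hHP, sum_const, card_univ,
    Fintype.card_fin, smul_eq_mul] at h1
  refine Nat.le_of_mul_le_mul_left ?_ (Nat.factorial_pos (Fintype.card α))
  linarith

/-! ### Shifted graphs with bounded matching number -/

lemma cast_choose_three (n : ℕ) : ((n.choose 3 : ℕ) : ℝ) = n * (n - 1) * (n - 2) / 6 := by
  induction n with
  | zero => simp
  | succ n ih =>
    rw [Nat.choose_succ_succ' n 2, Nat.cast_add, ih, Nat.cast_choose_two]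
    push_cast; ring

lemma IsShifted.pair_mem {F : Finset (Finset ℕ)} (hF : IsShifted F) {a b a' b' : ℕ}
    (h : {a, b} ∈ F) (hab : a < b) (hab' : a' < b') (ha : a' ≤ a) (hb : b' ≤ b) :
    {a', b'} ∈ F := by
  set f : ℕ → ℕ := fun x => if x = a then a' else b'
  have fa : f a = a' := if_pos rfl
  have fb : f b = b' := if_neg (by omega)
  have := hF.image_mem h (f := f)
    (by intro x hx y hy hxy
        simp only [coe_insert, coe_singleton, Set.mem_insert_iff, Set.mem_singleton_iff] at hx hy
        rcases hx with rfl | rfl <;> rcases hy with rfl | rfl <;>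
          simp only [fa, fb] at hxy <;> omega)
    (by intro x hx
        simp only [mem_insert, mem_singleton] at hx
        rcases hx with rfl | rfl <;> simp only [fa, fb] <;> omega)
  simpa only [image_insert, image_singleton, fa, fb] using this

lemma IsShifted.triple_mem {F : Finset (Finset ℕ)} (hF : IsShifted F) {a b c a' b' c' : ℕ}
    (h : {a, b, c} ∈ F) (hab : a < b) (hbc : b < c) (hab' : a' < b') (hbc' : b' < c')
    (ha : a' ≤ a) (hb : b' ≤ b) (hc : c' ≤ c) : {a', b', c'} ∈ F := by
  set f : ℕ → ℕ := fun x => if x = a then a' else if x = b then b' else c'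
  have fa : f a = a' := if_pos rfl
  have fb : f b = b' := by simp only [f]; simp only [if_neg hab.ne', if_true]
  have fc : f c = c' := by simp only [f]; rw [if_neg (by omega), if_neg (by omega)]
  have := hF.image_mem h (f := f)
    (by intro x hx y hy hxy
        simp only [coe_insert, coe_singleton, Set.mem_insert_iff, Set.mem_singleton_iff] at hx hy
        rcases hx with rfl | rfl | rfl <;> rcases hy with rfl | rfl | rfl <;>
          simp only [fa, fb, fc] at hxy <;> omega)
    (by intro x hx
        simp only [mem_insert, mem_singleton] at hx
        rcases hx with rfl | rfl | rfl <;> simp only [fa, fb, fc] <;> omega)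
  simpa only [image_insert, image_singleton, fa, fb, fc] using this

lemma exists_lt_of_card_eq_two {e : Finset ℕ} (h : #e = 2) : ∃ a b, a < b ∧ e = {a, b} := by
  obtain ⟨a, b, hab, rfl⟩ := card_eq_two.1 h
  rcases lt_or_gt_of_ne hab with h | h
  · exact ⟨a, b, h, rfl⟩
  · exact ⟨b, a, h, pair_comm _ _⟩

lemma exists_lt_of_card_eq_three {e : Finset ℕ} (h : #e = 3) :
    ∃ a b c, a < b ∧ b < c ∧ e = {a, b, c} := by
  have hne : e.Nonempty := card_pos.1 (by omega)
  have h2 : #(e.erase (e.min' hne)) = 2 := by rw [card_erase_of_mem (min'_mem _ _), h]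
  obtain ⟨b, c, hbc, hE⟩ := exists_lt_of_card_eq_two h2
  refine ⟨e.min' hne, b, c, ?_, hbc, ?_⟩
  · have hb : b ∈ e.erase (e.min' hne) := by rw [hE]; simp
    exact lt_of_le_of_ne (min'_le _ _ (mem_of_mem_erase hb)) (ne_of_mem_erase hb).symm
  · rw [← hE, insert_erase (min'_mem _ _)]

lemma MatchingLE.exists_pair_notMem {F : Finset (Finset ℕ)} {s : ℕ} (hs : MatchingLE F s) :
    ∃ i ≤ s, {i, 2 * s + 1 - i} ∉ F := by
  by_contra! h
  have := hs.card_le (ι := Fin (s + 1)) (fun i => {i.1, 2 * s + 1 - i.1})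
    (fun i => h i.1 (by omega)) (fun i => insert_nonempty _ _) (fun i j hij => by
      have : i.1 ≠ j.1 := fun h => hij (Fin.ext h)
      rw [disjoint_left]
      intro x hx hx'
      simp only [mem_insert, mem_singleton] at hx hx'
      omega)
  simp at this

/-- Take the least `r` such that not all pairs in `{0, …, 2 r + 1}` with sum `2 r + 1` belong to
`F`. Then the pairs with sum `2 r - 1` form a perfect matching of `{0, …, 2 r - 1}` inside `F`. If
`F` is a shifted graph, then `r` is its matching number. -/
lemma MatchingLE.exists_antidiagonal {F : Finset (Finset ℕ)} {s : ℕ} (hs : MatchingLE F s) :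
    ∃ r ≤ s, (∀ i < r, {i, 2 * r - 1 - i} ∈ F) ∧ ∃ i ≤ r, {i, 2 * r + 1 - i} ∉ F := by
  classical
  have hPs := hs.exists_pair_notMem
  have hP : ∃ r, ∃ i ≤ r, ({i, 2 * r + 1 - i} : Finset ℕ) ∉ F := ⟨s, hPs⟩
  refine ⟨Nat.find hP, Nat.find_min' hP hPs, ?_, Nat.find_spec hP⟩
  · intro i hi
    have := Nat.find_min hP (m := Nat.find hP - 1) (by omega)
    push Not at this
    have := this i (by omega)
    rwa [show 2 * (Nat.find hP - 1) + 1 - i = 2 * Nat.find hP - 1 - i by omega] at this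

/-- A shifted graph omitting `{i, 2 r + 1 - i}` has no edge `{a, b}` with `i ≤ a` and
`2 r + 1 - i ≤ b`, which bounds the number of its edges by `r m - r (r + 1) / 2`. -/
lemma IsShifted.card_graph_le {F : Finset (Finset ℕ)} (hF : IsShifted F) {m r : ℕ}
    (hm : F ⊆ powersetCard 2 (range m)) (h : ∃ i ≤ r, {i, 2 * r + 1 - i} ∉ F)
    (hrm : 3 * r + 2 ≤ m) : 2 * #F + r * (r + 1) ≤ 2 * (r * m) := by
  obtain ⟨i, hi, hnot⟩ := h
  have hsub : F ⊆ (powersetCard 2 (range m) \ powersetCard 2 (Ico i m)) ∪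
      powersetCard 2 (Ico i (2 * r + 1 - i)) := by
    intro e he
    obtain ⟨hem, hc⟩ := mem_powersetCard.1 (hm he)
    obtain ⟨a, b, hab, rfl⟩ := exists_lt_of_card_eq_two hc
    have hb : b < m := mem_range.1 (hem (by simp))
    rw [mem_union, mem_sdiff]
    by_cases hia : i ≤ a
    · right
      have hb' : b < 2 * r + 1 - i := by
        by_contra! h
        exact hnot (hF.pair_mem he hab (by omega) hia h)
      rw [mem_powersetCard]
      refine ⟨?_, hc⟩
      intro x hx
      simp only [mem_insert, mem_singleton] at hx
      rw [mem_Ico]; omega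
    · left
      refine ⟨hm he, fun h => hia ?_⟩
      exact (mem_Ico.1 ((mem_powersetCard.1 h).1 (mem_insert_self _ _))).1
  have h1 := (card_le_card hsub).trans (card_union_le _ _)
  rw [card_sdiff_of_subset (powersetCard_mono fun x hx => by
    rw [mem_Ico] at hx; exact mem_range.2 hx.2)] at h1
  simp only [card_powersetCard, card_range, Nat.card_Ico] at h1
  have h2 : (m - i).choose 2 ≤ m.choose 2 := Nat.choose_le_choose 2 (Nat.sub_le _ _)
  have h3 : #F + (m - i).choose 2 ≤ m.choose 2 + (2 * r + 1 - i - i).choose 2 := by omega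
  obtain ⟨k, rfl⟩ := Nat.exists_eq_add_of_le hi
  obtain ⟨l, rfl⟩ := Nat.exists_eq_add_of_le hrm
  rw [show 3 * (i + k) + 2 + l - i = 2 * i + 3 * k + 2 + l by omega,
    show 2 * (i + k) + 1 - i - i = 2 * k + 1 by omega] at h3
  have h4 : ∀ x : ℕ, ((x.choose 2 : ℕ) : ℚ) = x * (x - 1) / 2 := fun x => Nat.cast_choose_two ℚ x
  have h5 : ((#F : ℕ) : ℚ) + ((2 * i + 3 * k + 2 + l).choose 2 : ℕ) ≤
    ((3 * (i + k) + 2 + l).choose 2 : ℕ) + ((2 * k + 1).choose 2 : ℕ) := by exact_mod_cast h3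
  rw [h4, h4, h4] at h5
  push_cast at h5
  have h6 : (2 : ℚ) * #F + (i + k) * (i + k + 1) ≤ 2 * ((i + k) * (3 * (i + k) + 2 + l)) := by
    have : (0 : ℚ) ≤ k * (k + i + l + 1) := by positivity
    have : (0 : ℚ) ≤ k * i := by positivity
    have : (0 : ℚ) ≤ k * l := by positivity
    have : (0 : ℚ) ≤ k * k := by positivity
    have : (0 : ℚ) ≤ k := by positivity
    nlinarith
  exact_mod_cast h6

/-- A shifted graph containing `{r - 1, r}` is complete on `{0, …, r}`. -/
lemma IsShifted.choose_le_card {F : Finset (Finset ℕ)} (hF : IsShifted F) {r : ℕ} (hr : 0 < r)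
    (h : ∀ i < r, {i, 2 * r - 1 - i} ∈ F) : (r + 1).choose 2 ≤ #F := by
  conv_lhs => rw [← card_range (r + 1), ← card_powersetCard]
  refine card_le_card fun e he => ?_
  obtain ⟨hem, hc⟩ := mem_powersetCard.1 he
  obtain ⟨a, b, hab, rfl⟩ := exists_lt_of_card_eq_two hc
  have hb : b < r + 1 := mem_range.1 (hem (by simp))
  exact hF.pair_mem (h (r - 1) (by omega)) (by omega) hab (by omega) (by omega)

/-- If the matching number `r` of the graph `F₂` is small compared to `s`, many triples are
missing from `F₃`. The matching of `F₂` on the first `2 r` vertices leaves at most `s - r` disjoint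
members of `F₃` among the others, while these vertices have room for at least `s - 2 r / 3`
disjoint triples. Hence at least `r / 3` of them are missing on average. -/
lemma card_missing_of_matching {F₂ F₃ : Finset (Finset ℕ)} {s r : ℕ} (hrs : r ≤ s)
    (hs : 0 < s) (hM : MatchingLE (F₂ ∪ F₃) s) (hr : ∀ i < r, {i, 2 * r - 1 - i} ∈ F₂) :
    (r : ℝ) * (3 * s - 2 * r) ^ 2 ≤ 6 * #(powersetCard 3 (range (3 * s + 2)) \ F₃) := by
  classical
  obtain ⟨N, hN⟩ : ∃ N, N + 2 * r = 3 * s + 2 := ⟨3 * s + 2 - 2 * r, by omega⟩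
  set q := N / 3 with hq
  set emb : Fin N ↪ ℕ := ⟨fun i => 2 * r + i.1, fun i j h => Fin.ext (by simpa using h)⟩ with hemb
  have hemb' : ∀ i, emb i = 2 * r + i.1 := fun _ => rfl
  set H : Finset (Finset (Fin N)) := {e ∈ powersetCard 3 univ | e.map emb ∈ F₃} with hH
  have hHM : MatchingLE H (s - r) := by
    intro M hMH hd
    have := hM.card_le (ι := Fin r ⊕ M)
      (Sum.elim (fun i => {i.1, 2 * r - 1 - i.1}) fun e => e.1.map emb) ?_ ?_ ?_
    · simp only [Fintype.card_sum, Fintype.card_fin, Fintype.card_coe] at this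
      omega
    · rintro (i | e)
      · exact mem_union_left _ (hr i.1 i.2)
      · exact mem_union_right _ (mem_filter.1 (hMH e.2)).2
    · rintro (i | e)
      · exact insert_nonempty _ _
      · have := (mem_powersetCard.1 (mem_filter.1 (hMH e.2)).1).2
        simp only [Sum.elim_inr, map_nonempty]
        exact card_pos.1 (by omega)
    · have hx : ∀ (i : Fin r) (e : Finset (Fin N)),
          Disjoint ({i.1, 2 * r - 1 - i.1} : Finset ℕ) (e.map emb) := by
        intro i e
        rw [disjoint_left]
        intro x hx hx'
        obtain ⟨y, -, rfl⟩ := mem_map.1 hx'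
        simp only [mem_insert, mem_singleton, hemb'] at hx
        omega
      rintro (i | e) (j | e') hne
      · have : i.1 ≠ j.1 := fun h => hne (by rw [Fin.ext h])
        simp only [Sum.elim_inl]
        rw [disjoint_left]
        intro x hx hx'
        simp only [mem_insert, mem_singleton] at hx hx'
        omega
      · exact hx i e'
      · exact (hx j e).symm
      · simp only [Sum.elim_inr]
        rw [disjoint_map]
        exact hd e.2 e'.2 fun h => hne (by rw [Subtype.ext h])
  have hcard := hHM.mul_card_le (q := q) (fun e he => (mem_powersetCard.1 (mem_filter.1 he).1).2)
    (by rw [Fintype.card_fin]; omega)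
  rw [Fintype.card_fin] at hcard
  have hmiss : N.choose 3 ≤ #H + #(powersetCard 3 (range (3 * s + 2)) \ F₃) := by
    have h1 : #H + #{e ∈ powersetCard 3 (univ : Finset (Fin N)) | ¬ e.map emb ∈ F₃} =
        N.choose 3 := by
      rw [hH, card_filter_add_card_filter_not, card_powersetCard, card_univ, Fintype.card_fin]
    rw [← h1]
    refine Nat.add_le_add_left ?_ _
    refine card_le_card_of_injOn (fun e => e.map emb) ?_ ?_
    · intro e he
      simp only [coe_filter, mem_powersetCard, Set.mem_ofPred_eq] at he
      simp only [coe_sdiff, Set.mem_sdiff, mem_coe, mem_powersetCard, card_map]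
      refine ⟨⟨?_, he.1.2⟩, he.2⟩
      intro x hx
      obtain ⟨y, -, rfl⟩ := mem_map.1 hx
      rw [mem_range, hemb']
      omega
    · exact (map_injective emb).injOn
  set D := #(powersetCard 3 (range (3 * s + 2)) \ F₃)
  have hq0 : 0 < q := by omega
  have hNr : (N : ℝ) + 2 * r = 3 * s + 2 := by exact_mod_cast hN
  have hqN : 3 * (q : ℝ) ≤ N := by exact_mod_cast (by omega : 3 * q ≤ N)
  have hqN' : (N : ℝ) ≤ 3 * q + 2 := by exact_mod_cast (by omega : N ≤ 3 * q + 2)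
  have hq0' : (0 : ℝ) < q := by exact_mod_cast hq0
  have hr0 : (0 : ℝ) ≤ r := by positivity
  have hrs' : (r : ℝ) ≤ s := by exact_mod_cast hrs
  have hs' : (1 : ℝ) ≤ s := by exact_mod_cast hs
  have hC := cast_choose_three N
  have h1 : (q : ℝ) * #H ≤ (s - r) * (N.choose 3 : ℕ) := by
    have : ((q * #H : ℕ) : ℝ) ≤ ((s - r) * N.choose 3 : ℕ) := by exact_mod_cast hcard
    rwa [Nat.cast_mul, Nat.cast_mul, Nat.cast_sub hrs] at this
  have h2 : ((N.choose 3 : ℕ) : ℝ) ≤ #H + D := by exact_mod_cast hmiss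
  set C : ℝ := ((N.choose 3 : ℕ) : ℝ)
  set P : ℝ := (N - 1) * (N - 2) with hP
  have hP0 : 0 ≤ P := mul_nonneg (by linarith) (by linarith)
  have h3 : (q - (s - r)) * C ≤ q * D := by nlinarith
  have h4 : (r : ℝ) / 3 ≤ q - (s - r) := by linarith
  have h5 : (r : ℝ) / 3 * C ≤ q * D := (mul_le_mul_of_nonneg_right h4 (by positivity)).trans h3
  have h6 : 3 * q * P ≤ 6 * C := by
    rw [hC, hP]; nlinarith
  have h7 : (q : ℝ) * (r * P) ≤ q * (6 * D) := by nlinarith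
  have h8 := le_of_mul_le_mul_left h7 hq0'
  have h9 : (3 * s - 2 * r : ℝ) ^ 2 ≤ P := by
    rw [hP, show (N : ℝ) = 3 * s + 2 - 2 * r by linarith]; nlinarith
  exact (mul_le_mul_of_nonneg_left h9 hr0).trans h8

/-! ### Reduction to blocks of vertices -/

lemma block_eq {b u v i j : ℕ} (hi : i < b) (hj : j < b) (h : u * b + i = v * b + j) :
    u = v ∧ i = j := by
  have hb : 0 < b := by omega
  have h1 : (u * b + i) / b = u := by
    rw [add_comm, Nat.add_mul_div_right _ _ hb, Nat.div_eq_of_lt hi, zero_add]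
  have h2 : (v * b + j) / b = v := by
    rw [add_comm, Nat.add_mul_div_right _ _ hb, Nat.div_eq_of_lt hj, zero_add]
  have huv : u = v := by rw [← h1, ← h2, h]
  subst huv
  exact ⟨rfl, by omega⟩

/-- The reduced family of `F` on `N` blocks of `b` consecutive integers: the sets of two or three
blocks other than the last one whose set of greatest elements belongs to `F`. If `F` is shifted,
then all transversals of these blocks belong to `F`. -/
def blockFamily (F : Finset (Finset ℕ)) (N b : ℕ) : Finset (Finset (Fin N)) :=
  {e | (#e = 2 ∨ #e = 3) ∧ (∀ v ∈ e, v.1 + 1 < N) ∧ e.image (fun v => v.1 * b + (b - 1)) ∈ F}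

lemma IsShifted.transversal_mem {F : Finset (Finset ℕ)} (hF : IsShifted F) {N b : ℕ}
    {e : Finset (Fin N)} (he : e ∈ blockFamily F N b) {pos : Fin N → ℕ} (hpos : ∀ v, pos v < b) :
    e.image (fun v => v.1 * b + pos v) ∈ F := by
  obtain ⟨-, -, hE⟩ := (mem_filter.1 he).2
  set f : ℕ → ℕ := fun x => if h : x / b < N then (x / b) * b + pos ⟨x / b, h⟩ else x
  have hf : ∀ v : Fin N, f (v.1 * b + (b - 1)) = v.1 * b + pos v := by
    intro v
    have hb : 0 < b := (Nat.zero_le _).trans_lt (hpos v)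
    have h1 : (v.1 * b + (b - 1)) / b = v.1 := by
      rw [add_comm, Nat.add_mul_div_right _ _ hb, Nat.div_eq_of_lt (by omega), zero_add]
    have h2 : (v.1 * b + (b - 1)) / b < N := by rw [h1]; exact v.2
    simp only [f, dif_pos h2, h1]
  have := hF.image_mem hE (f := f) (by
      intro x hx y hy hxy
      simp only [coe_image, Set.mem_image, mem_coe] at hx hy
      obtain ⟨u, -, rfl⟩ := hx
      obtain ⟨v, -, rfl⟩ := hy
      rw [hf, hf] at hxy
      rw [(block_eq (hpos u) (hpos v) hxy).1]) (by
      intro x hx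
      obtain ⟨u, -, rfl⟩ := mem_image.1 hx
      rw [hf]
      have := hpos u
      omega)
  rw [image_image] at this
  rwa [show (fun v : Fin N => v.1 * b + pos v) = f ∘ fun v => v.1 * b + (b - 1) from
    funext fun v => (hf v).symm]

/-- Multiplying a fractional matching of the reduced family by the block size and rounding down
gives a matching of the original family. As there are at most `2 ^ N` reduced edges, rounding loses
at most `2 ^ N`. -/
lemma fractional_matching_le {F : Finset (Finset ℕ)} (hF : IsShifted F) {N b s : ℕ}
    (hM : MatchingLE F s) (hb : 0 < b) (hN : 3 * (s + 2 ^ N) ≤ N * b)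
    (y : blockFamily F N b → ℝ) (hy0 : ∀ e, 0 ≤ y e)
    (hy : ∀ v, ∑ e, (if v ∈ e.1 then y e else 0) ≤ 1) : ∑ e, y e ≤ (N : ℝ) / 3 := by
  classical
  set k : blockFamily F N b → ℕ := fun e => ⌊b * y e⌋₊ with hk
  have hb' : (0 : ℝ) < b := by exact_mod_cast hb
  have hk1 : ∀ e, (k e : ℝ) ≤ b * y e := fun e => Nat.floor_le (mul_nonneg hb'.le (hy0 e))
  have hk2 : ∀ e, b * y e ≤ k e + 1 := fun e => (Nat.lt_floor_add_one _).le
  have hload : ∀ v, Fintype.card {i : Σ e, Fin (k e) // v ∈ i.1.1} ≤ Fintype.card (Fin b) := by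
    intro v
    have h1 : Fintype.card {i : Σ e, Fin (k e) // v ∈ i.1.1} =
        ∑ e, (if v ∈ e.1 then k e else 0) := by
      rw [Fintype.card_subtype, card_filter, Fintype.sum_sigma]
      refine sum_congr rfl fun e _ => ?_
      split_ifs <;> simp
    rw [h1, Fintype.card_fin]
    have h2 : ((∑ e, (if v ∈ e.1 then k e else 0) : ℕ) : ℝ) ≤ b := by
      push_cast
      calc ∑ e, (if v ∈ e.1 then (k e : ℝ) else 0)
          ≤ ∑ e, b * (if v ∈ e.1 then y e else 0) := by
            refine sum_le_sum fun e _ => ?_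
            split_ifs
            · exact hk1 e
            · simp
        _ ≤ b * 1 := by
            rw [← mul_sum]; exact mul_le_mul_of_nonneg_left (hy v) hb'.le
        _ = b := mul_one _
    exact_mod_cast h2
  -- Inside each block, the copies of the reduced edges through it receive distinct positions.
  have φ := fun v => (Function.Embedding.nonempty_of_card_le (hload v)).some
  set pos : (Σ e, Fin (k e)) → Fin N → ℕ :=
    fun i v => if h : v ∈ i.1.1 then (φ v ⟨i, h⟩).1 else 0 with hposdef
  have hpos : ∀ i v, pos i v < b := fun i v => by
    simp only [hposdef]; split_ifs
    exacts [(φ v _).2, hb]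
  have hcard := hM.card_le (ι := Σ e, Fin (k e))
    (fun i => i.1.1.image fun v => v.1 * b + pos i v)
    (fun i => hF.transversal_mem i.1.2 (hpos i)) (fun i => by
      have := (mem_filter.1 i.1.2).2.1
      rw [image_nonempty, ← card_pos]; omega) (fun i j hij => by
      rw [disjoint_left]
      intro x hx hx'
      obtain ⟨u, hu, rfl⟩ := mem_image.1 hx
      obtain ⟨v, hv, hvu⟩ := mem_image.1 hx'
      obtain ⟨h1, h2⟩ := block_eq (hpos j v) (hpos i u) hvu
      obtain rfl := Fin.ext h1
      simp only [hposdef, dif_pos hu, dif_pos hv] at h2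
      have := (φ v).injective (Fin.ext h2)
      simp only [Subtype.mk.injEq] at this
      exact hij this.symm)
  rw [Fintype.card_sigma] at hcard
  simp only [Fintype.card_fin] at hcard
  have h1 : b * ∑ e, y e ≤ s + 2 ^ N := by
    calc b * ∑ e, y e = ∑ e, b * y e := mul_sum _ _ _
      _ ≤ ∑ e, ((k e : ℝ) + 1) := sum_le_sum fun e _ => hk2 e
      _ = (∑ e, k e : ℕ) + #(blockFamily F N b) := by
          rw [sum_add_distrib]; push_cast; simp
      _ ≤ s + 2 ^ N := by
          have h2 : #(blockFamily F N b) ≤ 2 ^ N := by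
            refine (card_le_univ _).trans ?_
            rw [Fintype.card_finset, Fintype.card_fin]
          have h3 : ((∑ e, k e : ℕ) : ℝ) ≤ s := by exact_mod_cast hcard
          have h4 : (#(blockFamily F N b) : ℝ) ≤ 2 ^ N := by exact_mod_cast h2
          exact add_le_add h3 h4
  have h2 : 3 * ((s : ℝ) + 2 ^ N) ≤ N * b := by exact_mod_cast hN
  rw [le_div_iff₀ (by norm_num)]
  refine le_of_mul_le_mul_left ?_ hb'
  linarith

/-- A pair in `F₂` with an element in the first block or with both elements in the same block is
counted by `2 b m`. For any other pair, the two blocks preceding those of its elements span a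
reduced edge, which has weight at least `1`. -/
lemma card_graph_le_blocks {F₂ F : Finset (Finset ℕ)} (hF : IsShifted F₂) (hFF : F₂ ⊆ F)
    {m N b : ℕ} (hm : F₂ ⊆ powersetCard 2 (range m)) (hb : 0 < b) (hmN : m ≤ N * b)
    {w : Fin N → ℝ} (hw : ∀ e ∈ blockFamily F N b, 1 ≤ ∑ v ∈ e, w v) :
    #F₂ ≤ 2 * b * m + #{p : Fin N × Fin N | p.1 < p.2 ∧ 1 ≤ w p.1 + w p.2} * (b * b) := by
  classical
  set P : Finset (Fin N × Fin N) := {p | p.1 < p.2 ∧ 1 ≤ w p.1 + w p.2} with hP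
  set A : Finset (ℕ × ℕ) := range b ×ˢ range m
  set B : Finset (ℕ × ℕ) := (range m ×ˢ range b).image fun p => ((p.1 / b) * b + p.2, p.1)
  set C : Finset (ℕ × ℕ) := (P ×ˢ (range b ×ˢ range b)).image
    fun q => ((q.1.1.1 + 1) * b + q.2.1, (q.1.2.1 + 1) * b + q.2.2)
  have hsub : F₂ ⊆ (A ∪ B ∪ C).image fun p => {p.1, p.2} := by
    intro e he
    obtain ⟨hem, hc⟩ := mem_powersetCard.1 (hm he)
    obtain ⟨x, y, hxy, rfl⟩ := exists_lt_of_card_eq_two hc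
    have hy : y < m := mem_range.1 (hem (by simp))
    refine mem_image.2 ⟨(x, y), ?_, rfl⟩
    have hx1 := Nat.div_add_mod' x b
    have hy1 := Nat.div_add_mod' y b
    have hx2 := Nat.mod_lt x hb
    have hy2 := Nat.mod_lt y hb
    have hle : x / b ≤ y / b := Nat.div_le_div_right hxy.le
    rw [mem_union, mem_union]
    rcases Nat.eq_zero_or_pos (x / b) with h0 | h0
    · left; left
      rw [h0, zero_mul, zero_add] at hx1
      exact mem_product.2 ⟨mem_range.2 (by dsimp only; omega), mem_range.2 hy⟩
    rcases hle.eq_or_lt with h1 | h1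
    · left; right
      refine mem_image.2 ⟨(y, x % b), mem_product.2 ⟨mem_range.2 hy, mem_range.2 hx2⟩, ?_⟩
      rw [← h1, hx1]
    · right
      have hyN : y / b < N := (Nat.div_lt_iff_lt_mul hb).2 (by omega)
      obtain ⟨u, hu⟩ := Nat.exists_eq_add_of_lt h0
      obtain ⟨v, hv⟩ : ∃ v, y / b = v + 1 := ⟨y / b - 1, by omega⟩
      rw [zero_add] at hu
      rw [hu, hv] at h1
      rw [hv] at hyN
      rw [hu] at hx1
      rw [hv] at hy1
      have hu' : u < N := by omega
      have hv' : v < N := by omega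
      refine mem_image.2 ⟨((⟨u, hu'⟩, ⟨v, hv'⟩), (x % b, y % b)),
        mem_product.2 ⟨?_, mem_product.2 ⟨mem_range.2 hx2, mem_range.2 hy2⟩⟩, ?_⟩
      · rw [hP, mem_filter]
        refine ⟨mem_univ _, by simpa using h1, ?_⟩
        have hne : (⟨u, hu'⟩ : Fin N) ≠ ⟨v, hv'⟩ := by
          simp only [ne_eq, Fin.mk.injEq]; omega
        have := hw {⟨u, hu'⟩, ⟨v, hv'⟩} (by
          refine mem_filter.2 ⟨mem_univ _, Or.inl (card_pair hne), ?_, hFF ?_⟩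
          · intro z hz
            simp only [mem_insert, mem_singleton] at hz
            rcases hz with rfl | rfl <;> simp only <;> omega
          · rw [image_insert, image_singleton]
            dsimp only
            rw [add_mul, one_mul] at hx1 hy1
            have : u * b + b ≤ v * b := by
              have := Nat.mul_le_mul_right b (show u + 1 ≤ v by omega)
              rwa [add_mul, one_mul] at this
            exact hF.pair_mem he hxy (by omega) (by omega) (by omega))
        rwa [sum_pair hne] at this
      · simp only [hx1, hy1]
  have hA : #A = b * m := by rw [card_product, card_range, card_range]
  have hB : #B ≤ m * b := card_image_le.trans (by rw [card_product, card_range, card_range])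
  have hC : #C ≤ #P * (b * b) := card_image_le.trans (by
    rw [card_product, card_product, card_range])
  calc #F₂ ≤ #((A ∪ B ∪ C).image fun p => ({p.1, p.2} : Finset ℕ)) := card_le_card hsub
    _ ≤ #(A ∪ B ∪ C) := card_image_le
    _ ≤ #A + #B + #C := (card_union_le _ _).trans (Nat.add_le_add_right (card_union_le _ _) _)
    _ ≤ 2 * b * m + #P * (b * b) := by nlinarith

lemma sorted_triple_inj {x y z x' y' z' : ℕ} (h1 : x < y) (h2 : y < z) (h1' : x' < y')
    (h2' : y' < z') (h : ({x, y, z} : Finset ℕ) = {x', y', z'}) : x = x' ∧ y = y' ∧ z = z' := by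
  have a1 : x ∈ ({x', y', z'} : Finset ℕ) := by rw [← h]; simp
  have a2 : y ∈ ({x', y', z'} : Finset ℕ) := by rw [← h]; simp
  have a3 : z ∈ ({x', y', z'} : Finset ℕ) := by rw [← h]; simp
  simp only [mem_insert, mem_singleton] at a1 a2 a3
  omega

/-- A triple of blocks of weight less than `1` is not a reduced edge, so that no triple with one
element in each of the following blocks belongs to `F`. The condition `p.2.2.1 + 3 ≤ N` keeps these
blocks inside the first `m` vertices. -/
lemma blocks_le_card_missing {F₃ F : Finset (Finset ℕ)} (hF : IsShifted F)
    (hFF : ∀ e ∈ F₃, e ∈ F) {m N b : ℕ} (hb : 0 < b) (hmN : (N - 1) * b ≤ m)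
    {w : Fin N → ℝ} (hw : ∀ e ∈ blockFamily F N b, 1 ≤ ∑ v ∈ e, w v) :
    #{p : Fin N × Fin N × Fin N | p.1 < p.2.1 ∧ p.2.1 < p.2.2 ∧ p.2.2.1 + 3 ≤ N ∧
      w p.1 + w p.2.1 + w p.2.2 < 1} * (b * (b * b)) ≤ #(powersetCard 3 (range m) \ F₃) := by
  classical
  set T : Finset (Fin N × Fin N × Fin N) := {p | p.1 < p.2.1 ∧ p.2.1 < p.2.2 ∧ p.2.2.1 + 3 ≤ N ∧
      w p.1 + w p.2.1 + w p.2.2 < 1} with hT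
  have hc : #(T ×ˢ (range b ×ˢ (range b ×ˢ range b))) = #T * (b * (b * b)) := by
    simp only [card_product, card_range]
  rw [← hc]
  have hlt : ∀ {u v i j : ℕ}, u < v → i < b → (u + 1) * b + i < (v + 1) * b + j := by
    intro u v i j huv hi
    have := Nat.mul_le_mul_right b (show u + 1 + 1 ≤ v + 1 by omega)
    rw [add_mul (u + 1), one_mul] at this
    omega
  refine card_le_card_of_injOn (fun q => {(q.1.1.1 + 1) * b + q.2.1, (q.1.2.1.1 + 1) * b + q.2.2.1,
    (q.1.2.2.1 + 1) * b + q.2.2.2}) ?_ ?_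
  · rintro ⟨⟨u, v, z⟩, i, j, k⟩ hq
    simp only [coe_product, Set.mem_prod, mem_coe, mem_range, hT, mem_filter, mem_univ,
      true_and] at hq
    obtain ⟨⟨huv, hvz, hz, hsum⟩, hi, hj, hk⟩ := hq
    have l1 : (u.1 + 1) * b + i < (v.1 + 1) * b + j := hlt huv hi
    have l2 : (v.1 + 1) * b + j < (z.1 + 1) * b + k := hlt hvz hj
    simp only [coe_sdiff, Set.mem_sdiff, mem_coe, mem_powersetCard]
    refine ⟨⟨?_, card_eq_three.2 ⟨_, _, _, l1.ne, (l1.trans l2).ne, l2.ne, rfl⟩⟩, fun hmem => ?_⟩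
    · have h1 : (z.1 + 1) * b + k < m := by
        have := Nat.mul_le_mul_right b (show z.1 + 1 + 1 ≤ N - 1 by omega)
        rw [add_mul (z.1 + 1), one_mul] at this
        omega
      intro x hx
      simp only [mem_insert, mem_singleton] at hx
      rw [mem_range]; omega
    · have := hw {u, v, z} (by
        refine mem_filter.2 ⟨mem_univ _,
          Or.inr (card_eq_three.2 ⟨_, _, _, huv.ne, (huv.trans hvz).ne, hvz.ne, rfl⟩), ?_, ?_⟩
        · intro t ht
          simp only [mem_insert, mem_singleton] at ht
          have := Fin.lt_def.1 huv
          have := Fin.lt_def.1 hvz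
          rcases ht with rfl | rfl | rfl <;> omega
        · rw [image_insert, image_insert, image_singleton]
          have huv' := Nat.mul_le_mul_right b (show u.1 + 1 ≤ v.1 from huv)
          have hvz' := Nat.mul_le_mul_right b (show v.1 + 1 ≤ z.1 from hvz)
          rw [add_mul, one_mul] at huv' hvz'
          have e1 := add_mul u.1 1 b
          have e2 := add_mul v.1 1 b
          have e3 := add_mul z.1 1 b
          rw [one_mul] at e1 e2 e3
          exact hF.triple_mem (hFF _ hmem) l1 l2 (by omega) (by omega) (by omega) (by omega)
            (by omega))
      rw [sum_insert (by simp [huv.ne, (huv.trans hvz).ne]), sum_pair hvz.ne] at this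
      linarith
  · rintro ⟨⟨u, v, z⟩, i, j, k⟩ hq ⟨⟨u', v', z'⟩, i', j', k'⟩ hq' h
    simp only [coe_product, Set.mem_prod, mem_coe, mem_range, hT, mem_filter, mem_univ,
      true_and] at hq hq'
    obtain ⟨⟨huv, hvz, -, -⟩, hi, hj, hk⟩ := hq
    obtain ⟨⟨huv', hvz', -, -⟩, hi', hj', hk'⟩ := hq'
    obtain ⟨h1, h2, h3⟩ := sorted_triple_inj (hlt huv hi) (hlt hvz hj) (hlt huv' hi') (hlt hvz' hj')
      h
    obtain ⟨a1, rfl⟩ := block_eq hi hi' h1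
    obtain ⟨a2, rfl⟩ := block_eq hj hj' h2
    obtain ⟨a3, rfl⟩ := block_eq hk hk' h3
    obtain rfl : u = u' := Fin.ext (by omega)
    obtain rfl : v = v' := Fin.ext (by omega)
    obtain rfl : z = z' := Fin.ext (by omega)
    rfl

/-- Apart from the order of the entries, triples of distinct blocks other than the last two make up
all but `9 N ^ 2` of the light triples. -/
lemma card_light_triples_le {N : ℕ} (w : Fin N → ℝ) :
    #{p : Fin N × Fin N × Fin N | w p.1 + w p.2.1 + w p.2.2 < 1} ≤
      6 * #{p : Fin N × Fin N × Fin N | p.1 < p.2.1 ∧ p.2.1 < p.2.2 ∧ p.2.2.1 + 3 ≤ N ∧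
        w p.1 + w p.2.1 + w p.2.2 < 1} + 9 * (N * N) := by
  classical
  set T : Finset (Fin N × Fin N × Fin N) := {p | p.1 < p.2.1 ∧ p.2.1 < p.2.2 ∧ p.2.2.1 + 3 ≤ N ∧
      w p.1 + w p.2.1 + w p.2.2 < 1} with hT
  -- `L` consists of the last two blocks; `S`, `D`, `E` are the light triples with distinct entries
  -- outside `L` by their order, the triples with two equal entries, and those meeting `L`.
  set L : Finset (Fin N) := {u | N < u.1 + 3} with hL
  have hL2 : #L ≤ 2 := by
    have h1 : L.image (fun u => N - 1 - u.1) ⊆ range 2 := by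
      intro x hx
      obtain ⟨u, hu, rfl⟩ := mem_image.1 hx
      have := (mem_filter.1 hu).2
      rw [mem_range]; omega
    rw [← card_image_of_injOn (s := L) (f := fun u => N - 1 - u.1)]
    · exact (card_le_card h1).trans (card_range 2).le
    · intro u _ v _ h
      have := u.2; have := v.2
      exact Fin.ext (by simp only at h; omega)
  set U : Finset (Fin N × Fin N) := univ
  have hU : #U = N * N := by simp [U]
  set S : Fin 6 → Finset (Fin N × Fin N × Fin N) := ![T, T.image fun p => (p.1, p.2.2, p.2.1),
    T.image fun p => (p.2.1, p.1, p.2.2), T.image fun p => (p.2.1, p.2.2, p.1),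
    T.image fun p => (p.2.2, p.1, p.2.1), T.image fun p => (p.2.2, p.2.1, p.1)]
  set D : Fin 3 → Finset (Fin N × Fin N × Fin N) := ![U.image fun p => (p.1, p.1, p.2),
    U.image fun p => (p.1, p.2, p.1), U.image fun p => (p.2, p.1, p.1)]
  set E : Fin 3 → Finset (Fin N × Fin N × Fin N) := ![(L ×ˢ U).image fun p => (p.1, p.2.1, p.2.2),
    (L ×ˢ U).image fun p => (p.2.1, p.1, p.2.2), (L ×ˢ U).image fun p => (p.2.1, p.2.2, p.1)]
  have hS : ∀ i, #(S i) ≤ #T := by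
    intro i; fin_cases i
    exacts [le_rfl, card_image_le, card_image_le, card_image_le, card_image_le, card_image_le]
  have hD : ∀ i, #(D i) ≤ N * N := by
    intro i; rw [← hU]; fin_cases i
    exacts [card_image_le, card_image_le, card_image_le]
  have hE : ∀ i, #(E i) ≤ 2 * (N * N) := by
    intro i
    have : #(L ×ˢ U) ≤ 2 * (N * N) := by
      rw [card_product, hU]; exact Nat.mul_le_mul_right _ hL2
    refine le_trans ?_ this
    fin_cases i
    exacts [card_image_le, card_image_le, card_image_le]
  have hsub : ({p | w p.1 + w p.2.1 + w p.2.2 < 1} : Finset (Fin N × Fin N × Fin N)) ⊆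
      univ.biUnion S ∪ (univ.biUnion D ∪ univ.biUnion E) := by
    rintro ⟨u, v, z⟩ h
    have h : w u + w v + w z < 1 := (mem_filter.1 h).2
    simp only [mem_union, mem_biUnion, mem_univ, true_and]
    by_cases hu : u ∈ L
    · exact Or.inr (Or.inr ⟨0, mem_image.2 ⟨(u, v, z), mem_product.2 ⟨hu, mem_univ _⟩, rfl⟩⟩)
    by_cases hv : v ∈ L
    · exact Or.inr (Or.inr ⟨1, mem_image.2 ⟨(v, u, z), mem_product.2 ⟨hv, mem_univ _⟩, rfl⟩⟩)
    by_cases hz : z ∈ L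
    · exact Or.inr (Or.inr ⟨2, mem_image.2 ⟨(z, u, v), mem_product.2 ⟨hz, mem_univ _⟩, rfl⟩⟩)
    have hL' : ∀ u : Fin N, u ∉ L → u.1 + 3 ≤ N := by
      intro u hu
      by_contra! h
      exact hu (mem_filter.2 ⟨mem_univ _, h⟩)
    have hu := hL' u hu
    have hv := hL' v hv
    have hz := hL' z hz
    rcases lt_trichotomy u v with h1 | rfl | h1
    · rcases lt_trichotomy v z with h2 | rfl | h2
      · exact Or.inl ⟨0, mem_filter.2 ⟨mem_univ _, h1, h2, hz, h⟩⟩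
      · exact Or.inr (Or.inl ⟨2, mem_image.2 ⟨(v, u), mem_univ _, rfl⟩⟩)
      · rcases lt_trichotomy u z with h3 | rfl | h3
        · exact Or.inl ⟨1, mem_image.2 ⟨(u, z, v), mem_filter.2
            ⟨mem_univ _, h3, h2, hv, by dsimp only; linarith⟩, rfl⟩⟩
        · exact Or.inr (Or.inl ⟨1, mem_image.2 ⟨(u, v), mem_univ _, rfl⟩⟩)
        · exact Or.inl ⟨3, mem_image.2 ⟨(z, u, v), mem_filter.2
            ⟨mem_univ _, h3, h1, hv, by dsimp only; linarith⟩, rfl⟩⟩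
    · exact Or.inr (Or.inl ⟨0, mem_image.2 ⟨(u, z), mem_univ _, rfl⟩⟩)
    · rcases lt_trichotomy u z with h2 | rfl | h2
      · exact Or.inl ⟨2, mem_image.2 ⟨(v, u, z), mem_filter.2
            ⟨mem_univ _, h1, h2, hz, by dsimp only; linarith⟩, rfl⟩⟩
      · exact Or.inr (Or.inl ⟨1, mem_image.2 ⟨(u, v), mem_univ _, rfl⟩⟩)
      · rcases lt_trichotomy v z with h3 | rfl | h3
        · exact Or.inl ⟨4, mem_image.2 ⟨(v, z, u), mem_filter.2
            ⟨mem_univ _, h3, h2, hu, by dsimp only; linarith⟩, rfl⟩⟩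
        · exact Or.inr (Or.inl ⟨2, mem_image.2 ⟨(v, u), mem_univ _, rfl⟩⟩)
        · exact Or.inl ⟨5, mem_image.2 ⟨(z, v, u), mem_filter.2
            ⟨mem_univ _, h3, h1, hu, by dsimp only; linarith⟩, rfl⟩⟩
  have c1 : #(univ.biUnion S) ≤ 6 * #T := by
    simpa using card_biUnion_le_card_mul univ S _ fun i _ => hS i
  have c2 : #(univ.biUnion D) ≤ 3 * (N * N) := by
    simpa using card_biUnion_le_card_mul univ D _ fun i _ => hD i
  have c3 : #(univ.biUnion E) ≤ 3 * (2 * (N * N)) := by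
    simpa using card_biUnion_le_card_mul univ E _ fun i _ => hE i
  have := (card_le_card hsub).trans ((card_union_le _ _).trans
    (Nat.add_le_add_left (card_union_le _ _) _))
  omega

/-! ### Triples missing because of pairs -/

lemma IsShifted.union {F G : Finset (Finset ℕ)} (hF : IsShifted F) (hG : IsShifted G) :
    IsShifted (F ∪ G) := by
  intro e he i j hij hj hi
  rcases mem_union.1 he with h | h
  · exact mem_union_left _ (hF e h i j hij hj hi)
  · exact mem_union_right _ (hG e h i j hij hj hi)

/-- Asymptotically, the number of missing triples is at least `s / 2` times the number of pairs.
Here `N` is the number of blocks, and the error term is of order `s ^ 3 / N`. -/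
lemma exists_missing_asymptotic (N : ℕ) (hN : 2 ≤ N) : ∃ s₀ : ℕ, ∀ s, s₀ ≤ s →
    ∀ F₂ F₃ : Finset (Finset ℕ), F₂ ⊆ powersetCard 2 (range (3 * s + 2)) →
      IsShifted F₂ → IsShifted F₃ → MatchingLE (F₂ ∪ F₃) s →
      (3 * s + 2 : ℝ) * #F₂ ≤
        6 * #(powersetCard 3 (range (3 * s + 2)) \ F₃) + 84 * (3 * s + 2) ^ 3 / N := by
  classical
  refine ⟨N * (N + 3 * 2 ^ N + 1), fun s hs F₂ F₃ h2 hF2 hF3 hM => ?_⟩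
  set m := 3 * s + 2 with hm
  set b := m / (N - 1) with hbdef
  have hN1 : 0 < N - 1 := by omega
  have hb1 : (N - 1) * b ≤ m := Nat.mul_div_le m (N - 1)
  have hb2 : m < (N - 1) * (b + 1) := Nat.lt_mul_div_succ m hN1
  have hb3 : N + 3 * 2 ^ N ≤ b := by
    rw [hbdef, Nat.le_div_iff_mul_le hN1]
    calc (N + 3 * 2 ^ N) * (N - 1) ≤ (N + 3 * 2 ^ N + 1) * N :=
          Nat.mul_le_mul (Nat.le_succ _) (Nat.sub_le _ _)
      _ ≤ m := by rw [mul_comm]; omega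
  have hNb : (N - 1) * b + b = N * b := by
    conv_rhs => rw [show N = N - 1 + 1 by omega, add_mul, one_mul]
  rw [mul_add, mul_one] at hb2
  have hb0 : 0 < b := by
    have : 0 < 2 ^ N := by positivity
    omega
  set F := F₂ ∪ F₃ with hFdef
  have hF : IsShifted F := hF2.union hF3
  obtain ⟨w, hw, hineq⟩ := exists_weight (R := blockFamily F N b)
    (fun e he => (mem_filter.1 he).2.1) (fun y hy0 hy1 => by
      rw [Fintype.card_fin]
      exact fractional_matching_le hF hM hb0 (by omega) y hy0 hy1)
  rw [Fintype.card_fin] at hineq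
  have hg := card_graph_le_blocks hF2 (subset_union_left : F₂ ⊆ F) h2 hb0 (by omega) hw
  have ht := blocks_le_card_missing hF (fun e he => mem_union_right F₂ he) hb0 hb1 hw
  have hl := card_light_triples_le w
  have hP : 2 * #{p : Fin N × Fin N | p.1 < p.2 ∧ 1 ≤ w p.1 + w p.2} ≤
      #{p : Fin N × Fin N | 1 ≤ w p.1 + w p.2} := by
    have h1 : #(image Prod.swap {p : Fin N × Fin N | p.1 < p.2 ∧ 1 ≤ w p.1 + w p.2}) =
        #{p : Fin N × Fin N | p.1 < p.2 ∧ 1 ≤ w p.1 + w p.2} :=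
      card_image_of_injective _ Prod.swap_injective
    rw [two_mul]
    nth_rw 2 [← h1]
    rw [← card_union_of_disjoint]
    · refine card_le_card fun p hp => ?_
      rcases mem_union.1 hp with hp | hp
      · exact mem_filter.2 ⟨mem_univ _, (mem_filter.1 hp).2.2⟩
      · obtain ⟨q, hq, rfl⟩ := mem_image.1 hp
        refine mem_filter.2 ⟨mem_univ _, ?_⟩
        rw [Prod.fst_swap, Prod.snd_swap, add_comm]; exact (mem_filter.1 hq).2.2
    · rw [disjoint_left]
      intro p hp hp'
      obtain ⟨q, hq, rfl⟩ := mem_image.1 hp'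
      exact absurd (mem_filter.1 hp).2.1 (lt_asymm (mem_filter.1 hq).2.1)
  set P := #{p : Fin N × Fin N | p.1 < p.2 ∧ 1 ≤ w p.1 + w p.2}
  set P' := #{p : Fin N × Fin N | 1 ≤ w p.1 + w p.2}
  set Q := #{p : Fin N × Fin N × Fin N | w p.1 + w p.2.1 + w p.2.2 < 1}
  set T := #{p : Fin N × Fin N × Fin N | p.1 < p.2.1 ∧ p.2.1 < p.2.2 ∧ p.2.2.1 + 3 ≤ N ∧
      w p.1 + w p.2.1 + w p.2.2 < 1}
  set D := #(powersetCard 3 (range m) \ F₃)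
  have hNb2 : N * b ≤ 2 * m := by
    have : b ≤ (N - 1) * b := Nat.le_mul_of_pos_left _ hN1
    omega
  have g1 : (#F₂ : ℝ) ≤ 2 * b * m + P * (b * b) := by exact_mod_cast hg
  have g2 : (T : ℝ) * (b * (b * b)) ≤ D := by exact_mod_cast ht
  have g3 : (Q : ℝ) ≤ 6 * T + 9 * (N * N) := by exact_mod_cast hl
  have g4 : (2 : ℝ) * P ≤ P' := by exact_mod_cast hP
  have g5 : (N : ℝ) * b ≤ 2 * m := by exact_mod_cast hNb2
  have g6 : (m : ℝ) ≤ N * b := by exact_mod_cast (by omega : m ≤ N * b)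
  have g7 : (3 * s + 2 : ℝ) = m := by rw [hm]; push_cast; ring
  rw [g7]
  have hN0 : (0 : ℝ) < N := by exact_mod_cast (by omega : 0 < N)
  have hbr : (0 : ℝ) < b := by exact_mod_cast hb0
  have hm0 : (0 : ℝ) ≤ m := by positivity
  have k1 : (N : ℝ) * P ≤ 6 * T + 9 * (N * N) := by nlinarith
  have k2 : (N * b : ℝ) * (P * (b * b)) ≤ 6 * D + 9 * b * (N * b) ^ 2 := by
    have := mul_le_mul_of_nonneg_right k1 (by positivity : (0 : ℝ) ≤ b * (b * b))
    nlinarith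
  have k3 : (m : ℝ) * (P * (b * b)) ≤ (N * b : ℝ) * (P * (b * b)) :=
    mul_le_mul_of_nonneg_right g6 (by positivity)
  have k4 : (m : ℝ) * #F₂ ≤ m * (2 * b * m + P * (b * b)) := mul_le_mul_of_nonneg_left g1 hm0
  have k5 : (N * b : ℝ) ^ 2 ≤ (2 * m) ^ 2 := pow_le_pow_left₀ (by positivity) g5 2
  have k6 : 9 * b * (N * b : ℝ) ^ 2 ≤ 9 * b * (2 * m) ^ 2 :=
    mul_le_mul_of_nonneg_left k5 (by positivity)
  have k7 : (b : ℝ) ≤ 2 * m / N := by rw [le_div_iff₀ hN0]; linarith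
  have k8 : (38 * (b : ℝ)) * m ^ 2 ≤ 38 * (2 * m / N) * m ^ 2 :=
    mul_le_mul_of_nonneg_right (by linarith) (by positivity)
  have k9 : 38 * (2 * m / N) * m ^ 2 ≤ 84 * (m : ℝ) ^ 3 / N := by
    rw [le_div_iff₀ hN0]
    have : 38 * (2 * m / N) * (m : ℝ) ^ 2 * N = 76 * m ^ 3 := by field_simp; ring
    rw [this]
    have : (0 : ℝ) ≤ (m : ℝ) ^ 3 := by positivity
    linarith
  nlinarith

/-- For large `s`, the number of missing triples is at least `49 s / 100` times the number of
pairs. Any constant below the value `1 / 2` of `exists_missing_asymptotic` could be attained; the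
two extremal constructions have the same size for `n - 3 s` about `0.4861 s`, and
`trace_bound_lt_of_large` needs a constant above `0.4861`. -/
lemma exists_missing_bound : ∃ s₀ : ℕ, ∀ s, s₀ ≤ s → ∀ F₂ F₃ : Finset (Finset ℕ),
    F₂ ⊆ powersetCard 2 (range (3 * s + 2)) → IsShifted F₂ → IsShifted F₃ →
      MatchingLE (F₂ ∪ F₃) s →
      (49 * s : ℝ) * #F₂ ≤ 100 * #(powersetCard 3 (range (3 * s + 2)) \ F₃) := by
  obtain ⟨s₀, h₀⟩ := exists_missing_asymptotic 10000000000 (by norm_num)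
  refine ⟨s₀ + 100, fun s hs F₂ F₃ h2 hF2 hF3 hM => ?_⟩
  obtain ⟨r, hrs, hr, hnot⟩ := (hM.mono subset_union_left).exists_antidiagonal
  rcases Nat.eq_zero_or_pos r with rfl | hr0
  · obtain ⟨i, hi, hnot⟩ := hnot
    have : F₂ = ∅ := by
      by_contra! h
      obtain ⟨e, he⟩ := h
      obtain ⟨a, b, hab, rfl⟩ := exists_lt_of_card_eq_two (mem_powersetCard.1 (h2 he)).2
      exact hnot (hF2.pair_mem he hab (by omega) (by omega) (by omega))
    rw [this]; simp
  set D := #(powersetCard 3 (range (3 * s + 2)) \ F₃)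
  have hs1 : (100 : ℝ) ≤ s := by exact_mod_cast (by omega : 100 ≤ s)
  have hr1 : (1 : ℝ) ≤ r := by exact_mod_cast hr0
  -- For `s < 200 r` there are at least `s ^ 2 / 80000` pairs, and with `10 ^ 10` blocks the error
  -- term of the asymptotic bound is small compared to `s` times this number.
  rcases le_or_gt (200 * r) s with hsmall | hlarge
  · have h1 := card_missing_of_matching hrs (by omega) hM hr
    have h3 := hF2.card_graph_le h2 hnot (by omega)
    have h4 : (#F₂ : ℝ) ≤ r * (3 * s + 2) := by
      have : #F₂ ≤ r * (3 * s + 2) := by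
        have := Nat.zero_le (r * (r + 1))
        omega
      exact_mod_cast this
    have h5 : (200 : ℝ) * r ≤ s := by exact_mod_cast hsmall
    have h6 : (2.99 * s : ℝ) ^ 2 ≤ (3 * s - 2 * r) ^ 2 :=
      pow_le_pow_left₀ (by linarith) (by linarith) 2
    have h7 : (r : ℝ) * (2.99 * s : ℝ) ^ 2 ≤ r * (3 * s - 2 * r) ^ 2 :=
      mul_le_mul_of_nonneg_left h6 (by linarith)
    have h8 : (49 * s : ℝ) * #F₂ ≤ 49 * s * (r * (3 * s + 2)) :=
      mul_le_mul_of_nonneg_left h4 (by linarith)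
    have h9 : 0 ≤ (r : ℝ) * s * (s - 100) := by
      have : (0 : ℝ) ≤ s - 100 := by linarith
      positivity
    nlinarith
  · have h1 := h₀ s (by omega) F₂ F₃ h2 hF2 hF3 hM
    have h3 := hF2.choose_le_card hr0 hr
    have h4 : (r : ℝ) * (r + 1) / 2 ≤ #F₂ := by
      have : (((r + 1).choose 2 : ℕ) : ℝ) ≤ #F₂ := by exact_mod_cast h3
      rw [Nat.cast_choose_two] at this
      push_cast at this
      linarith
    have h5 : (s : ℝ) < 200 * r := by exact_mod_cast hlarge
    have h6 : (s : ℝ) ^ 2 ≤ 80000 * #F₂ := by nlinarith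
    have h7 : (3 * s + 2 : ℝ) ^ 3 ≤ (4 * s) ^ 3 := pow_le_pow_left₀ (by linarith) (by linarith) 3
    have h8 : (s : ℝ) ^ 3 ≤ 80000 * (s * #F₂) := by nlinarith
    have h9 : 84 * (3 * s + 2 : ℝ) ^ 3 / ((10000000000 : ℕ) : ℝ) ≤ 0.05 * (s * #F₂) := by
      rw [div_le_iff₀ (by norm_num)]
      push_cast
      nlinarith
    have h10 : (0 : ℝ) ≤ #F₂ := by positivity
    have h11 : (0 : ℝ) ≤ s * #F₂ := by positivity
    nlinarith

/-! ### The two constructions -/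

/-- The triples inside `V` which meet `S`. -/
def coverFamily (V S : Finset ℕ) : Finset (Finset ℕ) := {e ∈ powersetCard 3 V | ¬ Disjoint e S}

/-- The larger one of the sizes of the two extremal constructions. -/
def extremalSize (n s : ℕ) : ℕ := max (n.choose 3 - (n - s).choose 3) ((3 * s + 2).choose 3)

lemma card_coverFamily {V S : Finset ℕ} (h : S ⊆ V) :
    #(coverFamily V S) = (#V).choose 3 - (#V - #S).choose 3 := by
  have h1 : {e ∈ powersetCard 3 V | Disjoint e S} = powersetCard 3 (V \ S) := by
    ext e
    simp only [mem_filter, mem_powersetCard, subset_sdiff]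
    tauto
  have h2 := card_filter_add_card_filter_not (s := powersetCard 3 V) (fun e => Disjoint e S)
  rw [h1, card_powersetCard, card_powersetCard, card_sdiff_of_subset h] at h2
  rw [coverFamily]
  omega

/-! ### Traces of a shifted family on the first `3 s + 2` vertices -/

/-- The pairs of elements less than `m` that form a member of `F` together with `m`. If `F` is
shifted, these include all two-element traces of members of `F` on `{0, …, m - 1}`. -/
def pairTrace (F : Finset (Finset ℕ)) (m : ℕ) : Finset (Finset ℕ) :=
  {e ∈ powersetCard 2 (range m) | insert m e ∈ F}

lemma IsShifted.pairTrace {F : Finset (Finset ℕ)} (hF : IsShifted F) (m : ℕ) :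
    IsShifted (pairTrace F m) := by
  intro e he i j hij hj hi
  obtain ⟨he1, he2⟩ := mem_filter.1 he
  obtain ⟨hem, hc⟩ := mem_powersetCard.1 he1
  have hjm := mem_range.1 (hem hj)
  have hie : i ∉ e.erase j := fun h => hi (mem_of_mem_erase h)
  refine mem_filter.2 ⟨mem_powersetCard.2 ⟨?_, ?_⟩, ?_⟩
  · intro x hx
    rcases mem_insert.1 hx with rfl | hx
    · exact mem_range.2 (by omega)
    · exact hem (mem_of_mem_erase hx)
  · have := card_pos.2 ⟨j, hj⟩
    rw [card_insert_of_notMem hie, card_erase_of_mem hj]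
    omega
  · have := hF _ he2 i j hij (mem_insert_of_mem hj) (by
      rw [mem_insert]; rintro (h | h)
      · omega
      · exact hi h)
    rwa [erase_insert_of_ne (by omega), insert_comm] at this

lemma IsShifted.filter_range {F : Finset (Finset ℕ)} (hF : IsShifted F) (m : ℕ) :
    IsShifted {e ∈ F | e ⊆ range m} := by
  intro e he i j hij hj hi
  obtain ⟨he1, he2⟩ := mem_filter.1 he
  refine mem_filter.2 ⟨hF e he1 i j hij hj hi, fun x hx => ?_⟩
  rcases mem_insert.1 hx with rfl | hx
  · exact mem_range.2 (hij.trans (mem_range.1 (he2 hj)))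
  · exact he2 (mem_of_mem_erase hx)

/-- Otherwise `s + 1` disjoint traces extend to `s + 1` disjoint members: these need `3 s + 3`
vertices altogether, and the vertices up to and including `3 s + 2` suffice. -/
lemma matchingLE_traces {F : Finset (Finset ℕ)} (hF : IsShifted F) (h3 : ∀ e ∈ F, #e = 3) {s : ℕ}
    (hM : MatchingLE F s) :
    MatchingLE (pairTrace F (3 * s + 2) ∪ {e ∈ F | e ⊆ range (3 * s + 2)}) s := by
  set m := 3 * s + 2 with hm
  intro M₀ hM₀ hd₀
  by_contra! hlt
  obtain ⟨M, hMM, hMc⟩ := exists_subset_card_eq (show s + 1 ≤ #M₀ from hlt)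
  have hMs := hMM.trans hM₀
  have hd : (M : Set (Finset ℕ)).PairwiseDisjoint id := hd₀.subset (coe_subset.2 hMM)
  set P := {e ∈ M | #e = 2} with hP
  set U := M.biUnion id with hU
  have hUm : U ⊆ range m := by
    intro x hx
    obtain ⟨e, he, hxe⟩ := mem_biUnion.1 hx
    rcases mem_union.1 (hMs he) with h | h
    · exact (mem_powersetCard.1 (mem_filter.1 h).1).1 hxe
    · exact (mem_filter.1 h).2 hxe
  have hUc : #U + #P = 3 * (s + 1) := by
    rw [hU, card_biUnion hd, hP, card_filter, ← sum_add_distrib,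
      sum_congr rfl (g := fun _ => 3) fun e he => ?_]
    · rw [sum_const, hMc, smul_eq_mul, mul_comm]
    · rcases mem_union.1 (hMs he) with h | h
      · have := (mem_powersetCard.1 (mem_filter.1 h).1).2
        simp [this]
      · have := h3 e (mem_filter.1 h).1
        simp [this]
  have hX : #P ≤ #(range (m + 1) \ U) := by
    rw [card_sdiff_of_subset (hUm.trans (range_mono (Nat.le_succ m))), card_range]
    omega
  obtain ⟨g⟩ : Nonempty (P ↪ (range (m + 1) \ U : Finset ℕ)) :=
    Function.Embedding.nonempty_of_card_le (by simpa only [Fintype.card_coe] using hX)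
  have hg : ∀ p, (g p).1 < m + 1 ∧ (g p).1 ∉ U := fun p => by
    have := mem_sdiff.1 (g p).2
    exact ⟨mem_range.1 this.1, this.2⟩
  set f : M → Finset ℕ := fun e => if h : e.1 ∈ P then insert (g ⟨e.1, h⟩).1 e.1 else e.1 with hf
  have hfsub : ∀ e, ∀ x ∈ f e, x ∈ e.1 ∨ ∃ h : e.1 ∈ P, x = (g ⟨e.1, h⟩).1 := by
    intro e x hx
    simp only [hf] at hx
    split_ifs at hx with h
    · rcases mem_insert.1 hx with h' | h'
      · exact Or.inr ⟨h, h'⟩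
      · exact Or.inl h'
    · exact Or.inl hx
  have := hM.card_le f ?_ ?_ ?_
  · rw [Fintype.card_coe] at this; omega
  · intro e
    simp only [hf]
    split_ifs with h
    · have h2 := (mem_filter.1 h).2
      rcases mem_union.1 (hMs e.2) with h' | h'
      · obtain ⟨h4, h5⟩ := mem_filter.1 h'
        have hme : m ∉ e.1 := fun h => by
          have := mem_range.1 ((mem_powersetCard.1 h4).1 h); omega
        have hge : (g ⟨e.1, h⟩).1 ∉ e.1 := fun hh =>
          (hg ⟨e.1, h⟩).2 (mem_biUnion.2 ⟨e.1, e.2, hh⟩)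
        rcases (Nat.lt_succ_iff.1 (hg ⟨e.1, h⟩).1).eq_or_lt with h6 | h6
        · rw [h6]; exact h5
        · have := hF _ h5 _ m h6 (mem_insert_self _ _) (by
            rw [mem_insert]; rintro (h | h)
            · omega
            · exact hge h)
          rwa [erase_insert hme] at this
      · have := h3 e.1 (mem_filter.1 h').1
        omega
    · rcases mem_union.1 (hMs e.2) with h' | h'
      · exact absurd (mem_filter.2 ⟨e.2, (mem_powersetCard.1 (mem_filter.1 h').1).2⟩) h
      · exact (mem_filter.1 h').1
  · intro e
    have hne : e.1.Nonempty := by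
      rw [← card_pos]
      rcases mem_union.1 (hMs e.2) with h' | h'
      · have := (mem_powersetCard.1 (mem_filter.1 h').1).2; omega
      · have := h3 e.1 (mem_filter.1 h').1; omega
    simp only [hf]
    split_ifs
    exacts [insert_nonempty _ _, hne]
  · intro e e' hne
    have hdis : Disjoint e.1 e'.1 := hd e.2 e'.2 fun h => hne (Subtype.ext h)
    rw [disjoint_left] at hdis ⊢
    intro x hx hx'
    rcases hfsub e x hx with h | ⟨h, hxg⟩ <;> rcases hfsub e' x hx' with h' | ⟨h', hxg'⟩
    · exact hdis h h'
    · exact (hg ⟨e'.1, h'⟩).2 (hxg' ▸ mem_biUnion.2 ⟨e.1, e.2, h⟩)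
    · exact (hg ⟨e.1, h⟩).2 (hxg ▸ mem_biUnion.2 ⟨e'.1, e'.2, h'⟩)
    · have := g.injective (Subtype.ext (hxg.symm.trans hxg'))
      simp only [Subtype.mk.injEq] at this
      exact hne (Subtype.ext this)

/-- If `{0, m, m + 1}` is missing from a shifted family, then every member has at most one element
that is not less than `m`. -/
lemma subset_traces {F : Finset (Finset ℕ)} (hF : IsShifted F) {n m : ℕ}
    (h3 : F ⊆ powersetCard 3 (range n)) (h0 : {0, m, m + 1} ∉ F) (hm : 0 < m) :
    F ⊆ {e ∈ F | e ⊆ range m} ∪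
      (pairTrace F m ×ˢ Ico m n).image fun p => insert p.2 p.1 := by
  intro e he
  obtain ⟨hen, hc⟩ := mem_powersetCard.1 (h3 he)
  obtain ⟨a, b, c, hab, hbc, rfl⟩ := exists_lt_of_card_eq_three hc
  have hcn : c < n := mem_range.1 (hen (by simp))
  rw [mem_union]
  rcases lt_or_ge c m with hcm | hcm
  · left
    refine mem_filter.2 ⟨he, fun x hx => ?_⟩
    simp only [mem_insert, mem_singleton] at hx
    rw [mem_range]; omega
  · right
    rcases lt_or_ge b m with hbm | hbm
    · refine mem_image.2 ⟨({a, b}, c), mem_product.2 ⟨mem_filter.2 ⟨mem_powersetCard.2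
        ⟨fun x hx => ?_, card_pair hab.ne⟩, ?_⟩, mem_Ico.2 ⟨hcm, hcn⟩⟩, ?_⟩
      · simp only [mem_insert, mem_singleton] at hx
        rw [mem_range]; omega
      · have := hF.triple_mem he hab hbc hab hbm le_rfl le_rfl hcm
        rwa [show ({a, b, m} : Finset ℕ) = insert m {a, b} by
          ext x; simp only [mem_insert, mem_singleton]; tauto] at this
      · ext x; simp only [mem_insert, mem_singleton]; tauto
    · exact absurd (hF.triple_mem he hab hbc hm (Nat.lt_succ_self m) (Nat.zero_le _) hbm
        (by omega)) h0

/-! ### Deleting a vertex that dominates -/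

/-- The members of `F` that avoid the vertex `0`, with all vertices moved down by one. -/
def tailFamily (F : Finset (Finset ℕ)) (n : ℕ) : Finset (Finset ℕ) :=
  {e ∈ powersetCard 3 (range (n - 1)) | e.map (addRightEmbedding 1) ∈ F}

lemma IsShifted.tailFamily {F : Finset (Finset ℕ)} (hF : IsShifted F) (n : ℕ) :
    IsShifted (tailFamily F n) := by
  intro e he i j hij hj hi
  obtain ⟨he1, he2⟩ := mem_filter.1 he
  obtain ⟨hen, hc⟩ := mem_powersetCard.1 he1
  have hie : i ∉ e.erase j := fun h => hi (mem_of_mem_erase h)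
  refine mem_filter.2 ⟨mem_powersetCard.2 ⟨?_, ?_⟩, ?_⟩
  · intro x hx
    rcases mem_insert.1 hx with rfl | hx
    · exact mem_range.2 (hij.trans (mem_range.1 (hen hj)))
    · exact hen (mem_of_mem_erase hx)
  · rw [card_insert_of_notMem hie, card_erase_of_mem hj]
    omega
  · have := hF _ he2 (i + 1) (j + 1) (by omega) (mem_map_of_mem (addRightEmbedding 1) hj) (by
      intro h
      obtain ⟨x, hx, hxi⟩ := mem_map.1 h
      simp only [addRightEmbedding_apply, Nat.add_right_cancel_iff] at hxi
      exact hi (hxi ▸ hx))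
    rw [map_insert, map_erase]
    exact this

/-- A matching of the tail family can be moved onto the vertices `0, …, 3 s + 2`, so that after
moving back it is disjoint from `{0, 3 s + 4, 3 s + 5}`, which belongs to `F`. -/
lemma matchingLE_tailFamily {F : Finset (Finset ℕ)} (hF : IsShifted F) {n s : ℕ}
    (hM : MatchingLE F (s + 1)) (h0 : {0, 3 * (s + 1) + 2, 3 * (s + 1) + 2 + 1} ∈ F) :
    MatchingLE (tailFamily F n) s := by
  intro M₀ hM₀ hd₀
  by_contra! hlt
  obtain ⟨M, hMM, hMc⟩ := exists_subset_card_eq (show s + 1 ≤ #M₀ from hlt)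
  obtain ⟨M', hM', hd', hc', hr'⟩ := (hF.tailFamily n).exists_initial (k := 3)
    (fun e he => (mem_powersetCard.1 (mem_filter.1 he).1).2) (by norm_num) (hMM.trans hM₀)
    (hd₀.subset (coe_subset.2 hMM))
  rw [hMc] at hc' hr'
  have hnew : {0, 3 * (s + 1) + 1, 3 * (s + 1) + 2} ∈ F :=
    hF.triple_mem h0 (by omega) (by omega) (by omega) (by omega) le_rfl (by omega) (by omega)
  have hx : ∀ e ∈ M', Disjoint ({0, 3 * (s + 1) + 1, 3 * (s + 1) + 2} : Finset ℕ)
      (e.map (addRightEmbedding 1)) := by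
    intro e he
    rw [disjoint_left]
    intro x hx hx'
    obtain ⟨y, hy, rfl⟩ := mem_map.1 hx'
    have := mem_range.1 (hr' e he hy)
    simp only [mem_insert, mem_singleton, addRightEmbedding_apply] at hx
    omega
  have := hM.card_le (ι := Option M')
    (fun i => i.elim {0, 3 * (s + 1) + 1, 3 * (s + 1) + 2} fun e => e.1.map (addRightEmbedding 1))
    ?_ ?_ ?_
  · rw [Fintype.card_option, Fintype.card_coe] at this; omega
  · rintro (_ | e)
    exacts [hnew, (mem_filter.1 (hM' e.2)).2]
  · rintro (_ | e)
    · exact insert_nonempty _ _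
    · have := (mem_powersetCard.1 (mem_filter.1 (hM' e.2)).1).2
      simp only [Option.elim_some]
      rw [map_nonempty, ← card_pos]; omega
  · rintro (_ | e) (_ | e') hne
    · exact absurd rfl hne
    · exact hx _ e'.2
    · exact (hx _ e.2).symm
    · simp only [Option.elim_some]
      rw [disjoint_map]
      exact hd' e.2 e'.2 fun h => hne (by rw [Subtype.ext h])

lemma subset_tailFamily {F : Finset (Finset ℕ)} {n : ℕ} (h3 : F ⊆ powersetCard 3 (range n)) :
    F ⊆ (powersetCard 2 (Ico 1 n)).image (insert 0) ∪
      (tailFamily F n).image fun e => e.map (addRightEmbedding 1) := by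
  intro e he
  obtain ⟨hen, hc⟩ := mem_powersetCard.1 (h3 he)
  rw [mem_union]
  by_cases h0 : 0 ∈ e
  · left
    refine mem_image.2 ⟨e.erase 0, mem_powersetCard.2 ⟨fun x hx => ?_, ?_⟩, insert_erase h0⟩
    · have h1 := mem_range.1 (hen (mem_of_mem_erase hx))
      have h2 := ne_of_mem_erase hx
      rw [mem_Ico]; omega
    · rw [card_erase_of_mem h0, hc]
  · right
    have himg : (e.image fun x => x - 1).map (addRightEmbedding 1) = e := by
      ext x
      simp only [mem_map, mem_image, addRightEmbedding_apply, exists_exists_and_eq_and]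
      constructor
      · rintro ⟨y, hy, rfl⟩
        have : y ≠ 0 := fun h => h0 (h ▸ hy)
        rwa [Nat.sub_add_cancel (by omega)]
      · intro hx
        have : x ≠ 0 := fun h => h0 (h ▸ hx)
        exact ⟨x, hx, by omega⟩
    refine mem_image.2 ⟨e.image fun x => x - 1, mem_filter.2 ⟨mem_powersetCard.2 ⟨?_, ?_⟩, ?_⟩,
      himg⟩
    · intro x hx
      obtain ⟨y, hy, rfl⟩ := mem_image.1 hx
      have h1 := mem_range.1 (hen hy)
      have : y ≠ 0 := fun h => h0 (h ▸ hy)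
      rw [mem_range]; omega
    · rw [← card_map (addRightEmbedding 1), himg, hc]
    · rwa [himg]

/-! ### Comparing the sizes of the two constructions -/

lemma cast_choose_three_sub {n s : ℕ} (h : s ≤ n) :
    (((n - s).choose 3 : ℕ) : ℝ) = (n - s) * (n - s - 1) * (n - s - 2) / 6 := by
  rw [cast_choose_three, Nat.cast_sub h]

lemma cover_size_succ (n s : ℕ) :
    (n + 1).choose 3 - (n + 1 - (s + 1)).choose 3 =
      n.choose 2 + (n.choose 3 - (n - s).choose 3) := by
  have h1 : (n - s).choose 3 ≤ n.choose 3 := Nat.choose_le_choose 3 (Nat.sub_le _ _)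
  have h2 : (n + 1).choose 3 = n.choose 2 + n.choose 3 := Nat.choose_succ_succ' n 2
  rw [h2, Nat.add_sub_add_right]
  omega

/-- In the range where the clique on `3 s + 2` vertices is at least as large as the cover
construction, adding a dominating vertex to it is worse than enlarging the clique. -/
lemma dominated_clique_lt {n s : ℕ} (hs : 1 ≤ s) (hn : 3 * s + 5 ≤ n)
    (h : n.choose 3 - (n - s).choose 3 ≤ (3 * s + 2).choose 3) :
    n.choose 2 + (3 * s + 2).choose 3 < (3 * (s + 1) + 2).choose 3 := by
  have h1 : n.choose 3 ≤ (n - s).choose 3 + (3 * s + 2).choose 3 := by omega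
  have h2 : ((n.choose 3 : ℕ) : ℝ) ≤ ((n - s).choose 3 : ℕ) + ((3 * s + 2).choose 3 : ℕ) := by
    exact_mod_cast h1
  rw [cast_choose_three_sub (by omega), cast_choose_three, cast_choose_three] at h2
  -- The hypothesis on the sizes fails for `n ≥ 5 s + 4`, and for smaller `n` a direct comparison
  -- is possible.
  suffices h3 : ((n.choose 2 : ℕ) : ℝ) + ((3 * s + 2).choose 3 : ℕ) <
      ((3 * (s + 1) + 2).choose 3 : ℕ) by exact_mod_cast h3
  rw [cast_choose_three, cast_choose_three, Nat.cast_choose_two]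
  push_cast at h2 ⊢
  have hs' : (1 : ℝ) ≤ s := by exact_mod_cast hs
  rcases le_or_gt (5 * s + 4) n with hc | hc
  · exfalso
    have hc' : (5 * s + 4 : ℝ) ≤ n := by exact_mod_cast hc
    obtain ⟨u, hu⟩ : ∃ u : ℝ, n = u + s := ⟨n - s, by ring⟩
    rw [hu] at h2 hc'
    have hu4 : (4 * s + 4 : ℝ) ≤ u := by linarith
    have h4 : (s : ℝ) * (3 * u ^ 2 + 3 * u * s + s ^ 2 - 6 * u - 3 * s + 2) ≤
        s * (27 * s ^ 2 + 27 * s + 6) := by nlinarith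
    have h5 := le_of_mul_le_mul_left h4 (by linarith)
    nlinarith
  · have hc' : (n : ℝ) ≤ 5 * s + 3 := by exact_mod_cast (by omega : n ≤ 5 * s + 3)
    have hn' : (3 * s + 5 : ℝ) ≤ n := by exact_mod_cast hn
    nlinarith

/-- With `t = n - (3 s + 2)`, `e₂` pairs, `e₃` triples and `D` missing triples: for `t < 0.49 s`
the missing triples outweigh the members with exactly two elements less than `3 s + 2`, so that the
clique is larger; for `t ≥ 0.49 s` the largest possible value of `e₂` is the worst case, and the
cover construction is larger. -/
lemma trace_bound_lt_of_large {s t e₂ e₃ D : ℕ} (hs : 1000 ≤ s) (he : 0 < e₂)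
    (hD : e₃ + D = (3 * s + 2).choose 3) (h1 : (49 * s : ℝ) * e₂ ≤ 100 * D)
    (h2 : 2 * e₂ + s * (s + 1) ≤ 2 * (s * (3 * s + 2))) :
    e₃ + t * e₂ < extremalSize (3 * s + 2 + t) s := by
  have hs' : (1000 : ℝ) ≤ s := by exact_mod_cast hs
  have he' : (1 : ℝ) ≤ e₂ := by exact_mod_cast he
  have hD' : (e₃ : ℝ) + D = ((3 * s + 2).choose 3 : ℕ) := by exact_mod_cast hD
  have h2' : (2 : ℝ) * e₂ + s * (s + 1) ≤ 2 * (s * (3 * s + 2)) := by exact_mod_cast h2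
  rw [extremalSize, lt_max_iff]
  rcases lt_or_ge (100 * t) (49 * s) with ht | ht
  · right
    have ht' : (100 : ℝ) * t < 49 * s := by exact_mod_cast ht
    have : ((e₃ + t * e₂ : ℕ) : ℝ) < ((3 * s + 2).choose 3 : ℕ) := by
      rw [← hD']
      push_cast
      nlinarith
    exact_mod_cast this
  · left
    have ht' : (49 : ℝ) * s ≤ 100 * t := by exact_mod_cast ht
    have h3 : (((3 * s + 2 + t - s).choose 3 + (e₃ + t * e₂) : ℕ) : ℝ) <
        ((3 * s + 2 + t).choose 3 : ℕ) := by
      rw [Nat.cast_add, cast_choose_three_sub (by omega), cast_choose_three]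
      rw [cast_choose_three] at hD'
      push_cast at hD' ⊢
      set x : ℝ := t - 49 / 100 * s
      have hx : 0 ≤ x := by simp only [x]; linarith
      have h4 : (e₃ : ℝ) + t * e₂ ≤ (3 * s + 2) * (3 * s + 2 - 1) * (3 * s + 2 - 2) / 6 +
          x * (s * (5 * s + 3) / 2) := by
        have : x * e₂ ≤ x * (s * (5 * s + 3) / 2) :=
          mul_le_mul_of_nonneg_left (by nlinarith) hx
        simp only [x] at this ⊢
        nlinarith
      have h5 : (2 * s + 2) * (2 * s + 1) * (2 * s) / 6 <
          (s : ℝ) * (t * (t - 1) / 2) + 49 / 100 * s * (s * (5 * s + 3) / 2) := by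
        have h6 : 49 / 100 * (s : ℝ) * (49 / 100 * s - 1) ≤ t * (t - 1) :=
          mul_le_mul (by linarith) (by linarith) (by linarith) (by linarith)
        have h7 : (2 * s + 2) * (2 * s + 1) * 2 / 6 <
          (49 / 100 * (s : ℝ) * (49 / 100 * s - 1) / 2) + 49 / 100 * (s * (5 * s + 3) / 2) := by
          nlinarith
        have h8 := mul_lt_mul_of_pos_left h7 (by linarith : (0 : ℝ) < s)
        nlinarith
      have h9 : (3 * s + 2 + t) * (3 * s + 2 + t - 1) * (3 * s + 2 + t - 2) / 6 =
          ((3 * s + 2 + t - s) * (3 * s + 2 + t - s - 1) * (3 * s + 2 + t - s - 2) / 6 : ℝ) +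
          (3 * s + 2) * (3 * s + 2 - 1) * (3 * s + 2 - 2) / 6
          - (2 * s + 2) * (2 * s + 1) * (2 * s) / 6
          + t * (s * (5 * s + 3) / 2) + s * (t * (t - 1) / 2) := by ring
      rw [h9]
      simp only [x] at h4
      linarith
    have h4 : (3 * s + 2 + t - s).choose 3 + (e₃ + t * e₂) < (3 * s + 2 + t).choose 3 := by
      exact_mod_cast h3
    omega

/-- For bounded `s`, the cover construction has order `n ^ 2` and the traces account for `O(n)`
triples only. -/
lemma trace_bound_lt_of_small {n s k e₂ e₃ t : ℕ} (hs : 1 ≤ s) (hsk : s ≤ k)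
    (hn : 10 * (3 * k + 2) ^ 3 ≤ n) (ht : t ≤ n) (h2 : e₂ ≤ (3 * s + 2).choose 2)
    (h3 : e₃ ≤ (3 * s + 2).choose 3) : e₃ + t * e₂ < extremalSize n s := by
  set μ := 3 * k + 2 with hμ
  have h2' : e₂ ≤ μ ^ 2 := (h2.trans (Nat.choose_le_choose 2 (by omega))).trans
    (Nat.choose_le_pow _ _)
  have h3' : e₃ ≤ μ ^ 3 := (h3.trans (Nat.choose_le_choose 3 (by omega))).trans
    (Nat.choose_le_pow _ _)
  have hμ2 : 2 ≤ μ := by omega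
  have hμ3 : 0 < μ ^ 3 := by positivity
  have hn0 : 1 ≤ n := by omega
  obtain ⟨l, rfl⟩ : ∃ l, n = l + 1 := ⟨n - 1, by omega⟩
  rw [extremalSize, lt_max_iff]
  left
  have h4 : l.choose 2 ≤ (l + 1).choose 3 - (l + 1 - s).choose 3 := by
    have : (l + 1 - s).choose 3 ≤ l.choose 3 := Nat.choose_le_choose 3 (by omega)
    have h' : (l + 1).choose 3 = l.choose 2 + l.choose 3 := Nat.choose_succ_succ' l 2
    omega
  refine lt_of_lt_of_le ?_ h4
  have h5 : e₃ + t * e₂ ≤ μ ^ 3 + (l + 1) * μ ^ 2 :=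
    Nat.add_le_add h3' (Nat.mul_le_mul ht h2')
  refine lt_of_le_of_lt h5 ?_
  have h6 : ((μ ^ 3 + (l + 1) * μ ^ 2 : ℕ) : ℝ) < (l.choose 2 : ℕ) := by
    rw [Nat.cast_choose_two]
    push_cast
    have hμ' : (2 : ℝ) ≤ μ := by exact_mod_cast hμ2
    have hl : 10 * (μ : ℝ) ^ 3 ≤ l + 1 := by exact_mod_cast hn
    have a1 : 2 * (μ : ℝ) ^ 2 ≤ μ ^ 3 := by nlinarith [sq_nonneg (μ : ℝ)]
    have a2 : (4 : ℝ) ≤ μ ^ 2 := by nlinarith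
    have a3 : (l + 1 : ℝ) * (2 * μ ^ 2) ≤ (l + 1) * ((l + 1) / 10) :=
      mul_le_mul_of_nonneg_left (by linarith) (by positivity)
    have a4 : (80 : ℝ) ≤ l + 1 := by linarith
    nlinarith
  exact_mod_cast h6

/-! ### Shifted families -/

/-- The bound for shifted families. The condition `n₀ + s ≤ n` rather than `n₀ ≤ n` is preserved by
the induction, which lowers both `n` and `s` by one. -/
theorem shifted_extremal : ∃ n₀ : ℕ, ∀ s n, n₀ + s ≤ n → 3 * s + 3 ≤ n →
    ∀ F ⊆ powersetCard 3 (range n), IsShifted F → MatchingLE F s →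
      #F ≤ extremalSize n s ∧ (#F = extremalSize n s →
        F = coverFamily (range n) (range s) ∨ F = powersetCard 3 (range (3 * s + 2))) := by
  obtain ⟨s₀, hs₀⟩ := exists_missing_bound
  refine ⟨10 * (3 * (s₀ + 1000) + 2) ^ 3, fun s => ?_⟩
  induction s with
  | zero =>
    intro n _ _ F h3 _ hM
    have : F = ∅ := by
      by_contra! h
      obtain ⟨e, he⟩ := h
      have := hM {e} (by simpa using he) (by simp)
      simp at this
    subst this
    exact ⟨Nat.zero_le _, fun _ => Or.inl (by simp [coverFamily])⟩
  | succ s ih =>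
    intro n hn hsn F h3 hF hM
    set m := 3 * (s + 1) + 2 with hm
    by_cases h0 : {0, m, m + 1} ∈ F
    · obtain ⟨l, rfl⟩ : ∃ l, n = l + 1 := ⟨n - 1, by omega⟩
      have hlm : s + 1 ≤ l + 1 := by omega
      set G := tailFamily F (l + 1) with hG
      have hG3 : G ⊆ powersetCard 3 (range l) := filter_subset _ _
      obtain ⟨ih1, ih2⟩ := ih l (by omega) (by omega) G hG3 (hF.tailFamily _)
        (matchingLE_tailFamily hF hM h0)
      have hsub := subset_tailFamily h3
      have hcard : #F ≤ l.choose 2 + #G := by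
        refine (card_le_card hsub).trans ((card_union_le _ _).trans
          (Nat.add_le_add (card_image_le.trans ?_) card_image_le))
        rw [card_powersetCard, Nat.card_Ico, Nat.add_sub_cancel]
      have hcov := cover_size_succ l s
      -- adding a dominating vertex to the smaller clique is not optimal
      have hclique : l.choose 3 - (l - s).choose 3 ≤ (3 * s + 2).choose 3 → 1 ≤ s →
          l.choose 2 + (3 * s + 2).choose 3 < m.choose 3 := fun h hs =>
        dominated_clique_lt hs (by omega) h
      have hle : l.choose 2 + extremalSize l s ≤ extremalSize (l + 1) (s + 1) := by
        rw [extremalSize, extremalSize, hcov]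
        rcases le_or_gt ((3 * s + 2).choose 3) (l.choose 3 - (l - s).choose 3) with hc | hc
        · rw [max_eq_left hc]; exact le_max_left _ _
        · rw [max_eq_right hc.le]
          rcases Nat.eq_zero_or_pos s with rfl | hs
          · simp at hc
          · exact (hclique hc.le hs).le.trans (le_max_right _ _)
      refine ⟨hcard.trans ((Nat.add_le_add_left ih1 _).trans hle), fun heq => Or.inl ?_⟩
      have hGeq : #G = extremalSize l s := by omega
      have hFeq : l.choose 2 + extremalSize l s = extremalSize (l + 1) (s + 1) := by omega
      have hGcov : G = coverFamily (range l) (range s) := by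
        rcases ih2 hGeq with h | h
        · exact h
        · rcases Nat.eq_zero_or_pos s with rfl | hs
          · rw [h]; simp [coverFamily]
          · exfalso
            have h4 : extremalSize l s = (3 * s + 2).choose 3 := by
              rw [← hGeq, h, card_powersetCard, card_range]
            have h5 : l.choose 3 - (l - s).choose 3 ≤ (3 * s + 2).choose 3 := by
              rw [← h4]; exact le_max_left _ _
            have h6 := hclique h5 hs
            have h7 : m.choose 3 ≤ extremalSize (l + 1) (s + 1) := le_max_right _ _
            omega
      have hGc : #G = l.choose 3 - (l - s).choose 3 := by
        rw [hGcov, card_coverFamily (range_mono (by omega)), card_range, card_range]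
      refine eq_of_subset_of_card_le (fun e he => ?_) ?_
      · refine mem_filter.2 ⟨h3 he, ?_⟩
        rw [not_disjoint_iff]
        rcases mem_union.1 (hsub he) with h | h
        · obtain ⟨e', -, rfl⟩ := mem_image.1 h
          exact ⟨0, mem_insert_self _ _, mem_range.2 (Nat.succ_pos s)⟩
        · obtain ⟨e', he', rfl⟩ := mem_image.1 h
          change e' ∈ G at he'
          rw [hGcov] at he'
          obtain ⟨x, hx, hxs⟩ := not_disjoint_iff.1 (mem_filter.1 he').2
          exact ⟨x + 1, mem_map_of_mem _ hx, mem_range.2 (Nat.succ_lt_succ (mem_range.1 hxs))⟩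
      · rw [card_coverFamily (range_mono hlm), card_range, card_range, hcov, heq, ← hFeq, ← hGeq,
          hGc]
    · have htr := subset_traces hF h3 h0 (by omega)
      have hMt := matchingLE_traces hF (fun e he => (mem_powersetCard.1 (h3 he)).2) hM
      set F₂ := pairTrace F m with hF₂
      set F₃ := {e ∈ F | e ⊆ range m} with hF₃
      have hF2s : F₂ ⊆ powersetCard 2 (range m) := filter_subset _ _
      have hF3s : F₃ ⊆ powersetCard 3 (range m) := fun e he =>
        mem_powersetCard.2 ⟨(mem_filter.1 he).2, (mem_powersetCard.1 (h3 (mem_filter.1 he).1)).2⟩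
      have hF3c : #F₃ ≤ m.choose 3 := by
        have := card_le_card hF3s
        rwa [card_powersetCard, card_range] at this
      have hF2c : #F₂ ≤ m.choose 2 := by
        have := card_le_card hF2s
        rwa [card_powersetCard, card_range] at this
      rcases F₂.eq_empty_or_nonempty with he | hne
      · rw [he, empty_product, image_empty, union_empty] at htr
        have hFc := (card_le_card htr).trans hF3c
        refine ⟨hFc.trans (le_max_right _ _), fun heq => Or.inr ?_⟩
        refine eq_of_subset_of_card_le (htr.trans hF3s) ?_
        rw [card_powersetCard, card_range, heq]
        exact le_max_right _ _
      · have hFc : #F ≤ #F₃ + (n - m) * #F₂ := by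
          refine (card_le_card htr).trans ((card_union_le _ _).trans
            (Nat.add_le_add_left (card_image_le.trans ?_) _))
          rw [card_product, Nat.card_Ico, mul_comm]
        suffices hlt : #F₃ + (n - m) * #F₂ < extremalSize n (s + 1) from
          ⟨by omega, fun heq => by omega⟩
        rcases le_or_gt (s + 1) (s₀ + 1000) with hsm | hlg
        · exact trace_bound_lt_of_small (by omega) hsm (by omega) (Nat.sub_le _ _) hF2c hF3c
        · have hex := (hMt.mono subset_union_left : MatchingLE F₂ (s + 1)).exists_pair_notMem
          obtain ⟨t, rfl⟩ := Nat.exists_eq_add_of_le (show m ≤ n by omega)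
          rw [Nat.add_sub_cancel_left]
          have hg := (hF.pairTrace m).card_graph_le hF2s hex (by omega)
          refine trace_bound_lt_of_large (D := #(powersetCard 3 (range m) \ F₃)) (by omega)
            (card_pos.2 hne) ?_ ?_ hg
          · rw [card_sdiff_of_subset hF3s, card_powersetCard, card_range]
            exact Nat.add_sub_cancel' hF3c
          · exact hs₀ (s + 1) (by omega) F₂ F₃ hF2s (hF.pairTrace m) (hF.filter_range m) hMt

/-! ### Compressions -/

section Compression

variable {F : Finset (Finset ℕ)} {i j : ℕ}

lemma union_sdiff_singleton (e : Finset ℕ) (hij : i ≠ j) :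
    (e ⊔ {i}) \ {j} = insert i (e.erase j) := by
  ext x
  simp only [sup_eq_union, mem_sdiff, mem_union, mem_singleton, mem_insert, mem_erase]
  constructor
  · rintro ⟨h | h, h'⟩
    exacts [Or.inr ⟨h', h⟩, Or.inl h]
  · rintro (rfl | ⟨h, h'⟩)
    exacts [⟨Or.inr rfl, hij⟩, ⟨Or.inl h', h⟩]

lemma compress_eq (hij : i ≠ j) {e : Finset ℕ} (hj : j ∈ e) (hi : i ∉ e) :
    UV.compress {i} {j} e = insert i (e.erase j) := by
  rw [UV.compress_of_disjoint_of_le (disjoint_singleton_left.2 hi) (singleton_subset_iff.2 hj),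
    union_sdiff_singleton e hij]

lemma compress_eq_self {e : Finset ℕ} (h : ¬ (j ∈ e ∧ i ∉ e)) : UV.compress {i} {j} e = e := by
  rw [UV.compress, if_neg]
  rintro ⟨h1, h2⟩
  exact h ⟨singleton_subset_iff.1 h2, disjoint_singleton_left.1 h1⟩

lemma of_mem_compression_of_notMem (hij : i ≠ j) {e : Finset ℕ} (he : e ∈ UV.compression {i} {j} F)
    (heF : e ∉ F) : i ∈ e ∧ j ∉ e ∧ insert j (e.erase i) ∈ F := by
  refine ⟨singleton_subset_iff.1 (UV.le_of_mem_compression_of_notMem he heF),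
    disjoint_singleton_left.1 (UV.disjoint_of_mem_compression_of_notMem he heF), ?_⟩
  rw [← union_sdiff_singleton e hij.symm]
  exact UV.sup_sdiff_mem_of_mem_compression_of_notMem he heF

lemma insert_erase_mem_of_mem_compression (hij : i ≠ j) {e : Finset ℕ}
    (he : e ∈ UV.compression {i} {j} F) (hj : j ∈ e) (hi : i ∉ e) : insert i (e.erase j) ∈ F := by
  rw [← union_sdiff_singleton e hij]
  exact UV.sup_sdiff_mem_of_mem_compression he (singleton_subset_iff.2 hj)
    (disjoint_singleton_left.2 hi)

lemma mem_compression_of_mem {e : Finset ℕ} (he : e ∈ F) (h : ¬ (j ∈ e ∧ i ∉ e)) :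
    e ∈ UV.compression {i} {j} F := by
  rw [← compress_eq_self h]; exact UV.compress_mem_compression he

lemma of_notMem_compression (hij : i ≠ j) {e : Finset ℕ} (he : e ∈ F)
    (heC : e ∉ UV.compression {i} {j} F) : j ∈ e ∧ i ∉ e ∧ insert i (e.erase j) ∉ F ∧
      insert i (e.erase j) ∈ UV.compression {i} {j} F := by
  have h : j ∈ e ∧ i ∉ e := by
    by_contra h
    exact heC (mem_compression_of_mem he h)
  refine ⟨h.1, h.2, fun hF => heC ?_, ?_⟩
  · exact UV.mem_compression.2 (Or.inl ⟨he, by rwa [compress_eq hij h.1 h.2]⟩)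
  · rw [← compress_eq hij h.1 h.2]; exact UV.compress_mem_compression he

lemma map_swap_of_mem {e : Finset ℕ} (hi : i ∈ e) (hj : j ∉ e) :
    e.map (Equiv.swap i j).toEmbedding = insert j (e.erase i) := by
  ext x
  simp only [mem_map_equiv, Equiv.symm_swap, mem_insert, mem_erase]
  rcases eq_or_ne x i with rfl | hxi
  · rw [Equiv.swap_apply_left]
    have : x ≠ j := fun h => hj (h ▸ hi)
    simp [hj, this]
  · rcases eq_or_ne x j with rfl | hxj
    · rw [Equiv.swap_apply_right]; simp [hi]
    · rw [Equiv.swap_apply_of_ne_of_ne hxi hxj]; simp [hxi, hxj]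

lemma map_swap_of_notMem {e : Finset ℕ} (hi : i ∉ e) (hj : j ∉ e) :
    e.map (Equiv.swap i j).toEmbedding = e := by
  ext x
  rw [mem_map_equiv, Equiv.symm_swap]
  rcases eq_or_ne x i with rfl | hxi
  · rw [Equiv.swap_apply_left]; simp [hi, hj]
  · rcases eq_or_ne x j with rfl | hxj
    · rw [Equiv.swap_apply_right]; simp [hi, hj]
    · rw [Equiv.swap_apply_of_ne_of_ne hxi hxj]

/-- Compressing does not create larger matchings. -/
lemma MatchingLE.compression {s : ℕ} (hM : MatchingLE F s) (hij : i ≠ j) :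
    MatchingLE (UV.compression {i} {j} F) s := by
  intro M hMC hd
  by_cases hMF : M ⊆ F
  · exact hM M hMF hd
  -- Otherwise swapping `i` and `j` moves the matching into `F`.
  obtain ⟨e₀, he₀, he₀F⟩ := not_subset.1 hMF
  obtain ⟨hi, hj, hmem⟩ := of_mem_compression_of_notMem hij (hMC he₀) he₀F
  rw [← card_map (mapEmbedding (Equiv.swap i j).toEmbedding).toEmbedding]
  refine hM _ (fun e' he' => ?_) (fun a ha b hb hab => ?_)
  · obtain ⟨e, he, rfl⟩ := mem_map.1 he'
    change e.map (Equiv.swap i j).toEmbedding ∈ F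
    rcases eq_or_ne e e₀ with rfl | hne
    · rwa [map_swap_of_mem hi hj]
    · have hie : i ∉ e := fun h => disjoint_left.1 (hd he he₀ hne) h hi
      by_cases hje : j ∈ e
      · rw [Equiv.swap_comm, map_swap_of_mem hje hie]
        exact insert_erase_mem_of_mem_compression hij (hMC he) hje hie
      · rw [map_swap_of_notMem hie hje]
        by_contra heF
        exact hie (of_mem_compression_of_notMem hij (hMC he) heF).1
  · obtain ⟨a, ha', rfl⟩ := mem_map.1 ha
    obtain ⟨b, hb', rfl⟩ := mem_map.1 hb
    exact (disjoint_map _).2 (hd ha' hb' fun h => hab (by rw [h]))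

lemma compression_subset {V : Finset ℕ} {k : ℕ} (h3 : F ⊆ powersetCard k V) (hi : i ∈ V) :
    UV.compression {i} {j} F ⊆ powersetCard k V := by
  intro e he
  rcases UV.mem_compression.1 he with h | ⟨-, b, hb, rfl⟩
  · exact h3 h.1
  · obtain ⟨h1, h2⟩ := mem_powersetCard.1 (h3 hb)
    refine mem_powersetCard.2 ⟨?_, (UV.card_compress (by simp) b).trans h2⟩
    rw [UV.compress]
    split_ifs
    · exact sdiff_subset.trans (union_subset h1 (singleton_subset_iff.2 hi))
    · exact h1

lemma sum_compression_lt (hij : i < j) {e : Finset ℕ} (he : e ∈ F) (hj : j ∈ e) (hi : i ∉ e)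
    (hF : insert i (e.erase j) ∉ F) :
    ∑ a ∈ UV.compression {i} {j} F, ∑ x ∈ a, x < ∑ a ∈ F, ∑ x ∈ a, x := by
  rw [UV.compression, sum_union UV.compress_disjoint, filter_image,
    sum_image UV.compress_injOn,
    ← sum_filter_add_sum_filter_not F (fun a => UV.compress {i} {j} a ∈ F)]
  refine Nat.add_lt_add_left (sum_lt_sum_of_nonempty ⟨e, ?_⟩ fun a ha => ?_) _
  · rw [mem_filter, compress_eq hij.ne hj hi]; exact ⟨he, hF⟩
  · obtain ⟨haF, ha⟩ := mem_filter.1 ha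
    have h : j ∈ a ∧ i ∉ a := by
      by_contra h
      rw [compress_eq_self h] at ha
      exact ha haF
    rw [compress_eq hij.ne h.1 h.2, sum_insert fun h' => h.2 (mem_of_mem_erase h'),
      ← add_sum_erase a _ h.1]
    omega

end Compression

/-! ### Reversing a compression -/

lemma MatchingLE.card_add_two_le {F : Finset (Finset ℕ)} {s : ℕ} (hM : MatchingLE F s)
    {ι : Type*} [Fintype ι] {f : ι → Finset ℕ} (hf : ∀ x, f x ∈ F) (hne : ∀ x, (f x).Nonempty)
    (hd : ∀ x y, x ≠ y → Disjoint (f x) (f y)) {a b : Finset ℕ} (ha : a ∈ F) (hb : b ∈ F)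
    (ha0 : a.Nonempty) (hb0 : b.Nonempty) (hab : Disjoint a b) (haf : ∀ x, Disjoint a (f x))
    (hbf : ∀ x, Disjoint b (f x)) : Fintype.card ι + 2 ≤ s := by
  have := hM.card_le (ι := Option (Option ι)) (fun o => o.elim a fun o => o.elim b f) ?_ ?_ ?_
  · simpa only [Fintype.card_option] using this
  · rintro (_ | _ | x)
    exacts [ha, hb, hf x]
  · rintro (_ | _ | x)
    exacts [ha0, hb0, hne x]
  · rintro (_ | _ | x) (_ | _ | y) h
    · exact absurd rfl h
    · exact hab
    · exact haf y
    · exact hab.symm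
    · exact absurd rfl h
    · exact hbf y
    · exact (haf x).symm
    · exact (hbf x).symm
    · exact hd x y fun h' => h (by rw [h'])

/-- If a compression replaced some but not all of the pairs `R ⊆ W` for which `insert i R` belongs
to the compressed family, then there are two disjoint pairs of which it replaced exactly one: the
Kneser graph of pairs in a set of at least five elements is connected. -/
lemma exists_disjoint_pairs {F : Finset (Finset ℕ)} {W : Finset ℕ} {i j : ℕ} (hij : i ≠ j)
    (hW : 5 ≤ #W) (hi : i ∉ W) (hA : ∀ R ∈ powersetCard 2 W, insert i R ∈ UV.compression {i} {j} F)
    {P Q : Finset ℕ} (hP : P ∈ powersetCard 2 W) (hQ : Q ∈ powersetCard 2 W)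
    (hPF : insert i P ∈ F) (hQF : insert i Q ∉ F) :
    ∃ P' ∈ powersetCard 2 W, ∃ Q' ∈ powersetCard 2 W, Disjoint P' Q' ∧ insert i P' ∈ F ∧
      insert j Q' ∈ F := by
  have key : ∀ R ∈ powersetCard 2 W, insert i R ∉ F → insert j R ∈ F := by
    intro R hR hRF
    have := (of_mem_compression_of_notMem hij (hA R hR) hRF).2.2
    rwa [erase_insert fun h => hi ((mem_powersetCard.1 hR).1 h)] at this
  by_cases hPQ : Disjoint P Q
  · exact ⟨P, hP, Q, hQ, hPQ, hPF, key Q hQ hQF⟩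
  have hP' := mem_powersetCard.1 hP
  have hQ' := mem_powersetCard.1 hQ
  have h1 : #(P ∪ Q) ≤ 3 := by
    have h2 : 0 < #(P ∩ Q) := card_pos.2 (not_disjoint_iff_nonempty_inter.1 hPQ)
    have h3 := card_union_add_card_inter P Q
    omega
  obtain ⟨R, hR, hRc⟩ := exists_subset_card_eq (s := W \ (P ∪ Q)) (n := 2) (by
    have := le_card_sdiff (P ∪ Q) W
    omega)
  have hRW : R ∈ powersetCard 2 W := mem_powersetCard.2 ⟨hR.trans sdiff_subset, hRc⟩
  have hRd : Disjoint R (P ∪ Q) := disjoint_sdiff_self_left.mono_left hR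
  rw [disjoint_union_right] at hRd
  by_cases hRF : insert i R ∈ F
  · exact ⟨R, hRW, Q, hQ, hRd.2, hRF, key Q hQ hQF⟩
  · exact ⟨P, hP, R, hRW, hRd.1.symm, hPF, key R hRW hRF⟩

lemma disjoint_insert_insert {W P Q : Finset ℕ} {i j : ℕ} (hij : i ≠ j) (hi : i ∉ W) (hj : j ∉ W)
    (hP : P ⊆ W) (hQ : Q ⊆ W) (h : Disjoint P Q) : Disjoint (insert i P) (insert j Q) := by
  rw [disjoint_insert_left, disjoint_insert_right, mem_insert]
  exact ⟨fun h' => h'.elim hij fun h' => hi (hQ h'), fun h' => hj (hP h'), h⟩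

/-- If a compression of `F` is a cover family and `F` is not, then there are disjoint members of `F`
of the form `insert i P` and `insert j Q`, and each element of `S` other than `i` lies in a triple
that the compression did not change. Together these are `s + 1` disjoint members. -/
lemma eq_cover_of_compression {F : Finset (Finset ℕ)} {V S : Finset ℕ} {s i j : ℕ}
    (hM : MatchingLE F s) (h3 : F ⊆ powersetCard 3 V) (hV : 3 * s + 3 ≤ #V) (hV' : 10 ≤ #V)
    (hij : i ≠ j) (hj : j ∈ V) (hS : S ⊆ V) (hSc : #S = s)
    (hC : UV.compression {i} {j} F = coverFamily V S) :
    ∃ S' ⊆ V, #S' = s ∧ F = coverFamily V S' := by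
  have hcard : #F = #(coverFamily V S) := by rw [← hC, UV.card_compression]
  by_cases hFC : F ⊆ UV.compression {i} {j} F
  · exact ⟨S, hS, hSc, eq_of_subset_of_card_le (hC ▸ hFC) hcard.ge⟩
  obtain ⟨e, he, heC⟩ := not_subset.1 hFC
  obtain ⟨hje, hie, heF, heC'⟩ := of_notMem_compression hij he heC
  rw [hC] at heC heC'
  have heV := mem_powersetCard.1 (h3 he)
  have heS : Disjoint e S := by
    by_contra h; exact heC (mem_filter.2 ⟨h3 he, h⟩)
  have hjS : j ∉ S := disjoint_left.1 heS hje
  have hiS : i ∈ S := by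
    have := (mem_filter.1 heC').2
    rw [disjoint_insert_left, not_and] at this
    by_contra h
    exact this h (heS.mono_left (erase_subset _ _))
  have hi : i ∈ V := hS hiS
  have hs0 : 0 < s := hSc ▸ card_pos.2 ⟨i, hiS⟩
  have hS'V : insert j (S.erase i) ⊆ V := insert_subset hj ((erase_subset _ _).trans hS)
  have hS'c : #(insert j (S.erase i)) = s := by
    rw [card_insert_of_notMem fun h => hjS (mem_of_mem_erase h), card_erase_of_mem hiS]
    omega
  refine ⟨insert j (S.erase i), hS'V, hS'c, eq_of_subset_of_card_le (fun f hf => ?_) ?_⟩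
  swap
  · rw [hcard, card_coverFamily hS'V, card_coverFamily hS, hS'c, hSc]
  by_contra hfc
  have hfV := mem_powersetCard.1 (h3 hf)
  have hfS : Disjoint f (insert j (S.erase i)) := by
    by_contra h; exact hfc (mem_filter.2 ⟨h3 hf, h⟩)
  rw [disjoint_insert_right] at hfS
  obtain ⟨hjf, hfS⟩ := hfS
  have hif : i ∈ f := by
    have := mem_compression_of_mem (i := i) hf fun h => hjf h.1
    rw [hC] at this
    obtain ⟨x, hxf, hxS⟩ := not_disjoint_iff.1 (mem_filter.1 this).2
    rcases eq_or_ne x i with rfl | hne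
    · exact hxf
    · exact absurd (mem_erase.2 ⟨hne, hxS⟩) (disjoint_left.1 hfS hxf)
  -- the vertices outside `S` and `j`
  set W := V \ insert j S with hW
  have hWc : #W + s + 1 = #V := by
    rw [hW, card_sdiff_of_subset (insert_subset hj hS), card_insert_of_notMem hjS]
    have := card_le_card hS
    omega
  have hWmem : ∀ x, x ∈ W ↔ x ∈ V ∧ x ≠ j ∧ x ∉ S := fun x => by
    rw [hW, mem_sdiff, mem_insert]; tauto
  have hiW : i ∉ W := fun h => ((hWmem i).1 h).2.2 hiS
  have hjW : j ∉ W := fun h => ((hWmem j).1 h).2.1 rfl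
  have hP : f.erase i ∈ powersetCard 2 W := by
    refine mem_powersetCard.2 ⟨fun x hx => ?_, by rw [card_erase_of_mem hif, hfV.2]⟩
    have hx' := mem_erase.1 hx
    exact (hWmem x).2 ⟨hfV.1 hx'.2, fun h => hjf (h ▸ hx'.2), fun h =>
      disjoint_left.1 hfS hx'.2 (mem_erase.2 ⟨hx'.1, h⟩)⟩
  have hQ : e.erase j ∈ powersetCard 2 W := by
    refine mem_powersetCard.2 ⟨fun x hx => ?_, by rw [card_erase_of_mem hje, heV.2]⟩
    have hx' := mem_erase.1 hx
    exact (hWmem x).2 ⟨heV.1 hx'.2, hx'.1, disjoint_left.1 heS hx'.2⟩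
  obtain ⟨P, hPW, Q, hQW, hPQ, hPF, hQF⟩ := exists_disjoint_pairs hij (by omega) hiW
    (fun R hR => by
      obtain ⟨hRW, hRc⟩ := mem_powersetCard.1 hR
      rw [hC]
      refine mem_filter.2 ⟨mem_powersetCard.2 ⟨insert_subset hi (hRW.trans sdiff_subset), ?_⟩, ?_⟩
      · rw [card_insert_of_notMem fun h => hiW (hRW h), hRc]
      · exact not_disjoint_iff.2 ⟨i, mem_insert_self _ _, hiS⟩)
    hP hQ (by rwa [insert_erase hif]) heF
  obtain ⟨hPW, hPc⟩ := mem_powersetCard.1 hPW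
  obtain ⟨hQW, hQc⟩ := mem_powersetCard.1 hQW
  -- each of the other vertices of `S` gets two of the remaining vertices of `W`
  obtain ⟨g⟩ : Nonempty ({x // x ∈ S.erase i} × Fin 2 ↪ {x // x ∈ W \ (P ∪ Q)}) := by
    refine Function.Embedding.nonempty_of_card_le ?_
    have h1 := card_union_of_disjoint hPQ
    rw [Fintype.card_prod, Fintype.card_coe, Fintype.card_coe, Fintype.card_fin,
      card_erase_of_mem hiS, card_sdiff_of_subset (union_subset hPW hQW)]
    omega
  have hg : ∀ p, (g p).1 ∈ W ∧ (g p).1 ∉ P ∧ (g p).1 ∉ Q := fun p => by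
    have := mem_sdiff.1 (g p).2
    rw [mem_union, not_or] at this
    exact this
  have hginj : ∀ p q, (g p).1 = (g q).1 → p = q := fun p q h => g.injective (Subtype.ext h)
  have hx : ∀ x : (S.erase i : Finset ℕ), x.1 ≠ i ∧ x.1 ∈ S := fun x => mem_erase.1 x.2
  have hne : ∀ (x : (S.erase i : Finset ℕ)) p, x.1 ≠ (g p).1 := fun x p h =>
    ((hWmem _).1 (hg p).1).2.2 (h ▸ (hx x).2)
  have hdis : ∀ (R : Finset ℕ), R ⊆ W → (∀ p, (g p).1 ∉ R) → ∀ k, (k = i ∨ k = j) →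
      ∀ x : (S.erase i : Finset ℕ),
        Disjoint (insert k R) ({x.1, (g (x, 0)).1, (g (x, 1)).1} : Finset ℕ) := by
    intro R hRW hgR k hk x
    have hkW : k ∉ W := by rcases hk with rfl | rfl <;> assumption
    have hkx : x.1 ≠ k := by
      rcases hk with rfl | rfl
      · exact (hx x).1
      · exact fun h => hjS (h ▸ (hx x).2)
    rw [disjoint_left]
    intro y hy hy'
    simp only [mem_insert, mem_singleton] at hy'
    rcases mem_insert.1 hy with rfl | hy
    · rcases hy' with h | h | h
      · exact hkx h.symm
      · exact hkW (h ▸ (hg _).1)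
      · exact hkW (h ▸ (hg _).1)
    · rcases hy' with h | h | h
      · exact ((hWmem y).1 (hRW hy)).2.2 (h ▸ (hx x).2)
      · exact hgR _ (h ▸ hy)
      · exact hgR _ (h ▸ hy)
  have := hM.card_add_two_le (ι := (S.erase i : Finset ℕ))
    (f := fun x => {x.1, (g (x, 0)).1, (g (x, 1)).1}) (fun x => ?_)
    (fun x => insert_nonempty _ _) (fun x y hxy => ?_) hPF hQF (insert_nonempty _ _)
    (insert_nonempty _ _) (disjoint_insert_insert hij hiW hjW hPW hQW hPQ)
    (hdis P hPW (fun p => (hg p).2.1) i (Or.inl rfl))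
    (hdis Q hQW (fun p => (hg p).2.2) j (Or.inr rfl))
  · rw [Fintype.card_coe, card_erase_of_mem hiS] at this
    omega
  · have hmem : ({x.1, (g (x, 0)).1, (g (x, 1)).1} : Finset ℕ) ∈ UV.compression {i} {j} F := by
      rw [hC]
      refine mem_filter.2 ⟨mem_powersetCard.2 ⟨?_, ?_⟩, ?_⟩
      · intro y hy
        simp only [mem_insert, mem_singleton] at hy
        rcases hy with rfl | rfl | rfl
        · exact hS (hx x).2
        · exact ((hWmem _).1 (hg _).1).1
        · exact ((hWmem _).1 (hg _).1).1
      · refine card_eq_three.2 ⟨_, _, _, hne x _, hne x _, fun h => ?_, rfl⟩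
        have := hginj _ _ h
        simp at this
      · exact not_disjoint_iff.2 ⟨x.1, mem_insert_self _ _, (hx x).2⟩
    by_contra hnot
    have := (of_mem_compression_of_notMem hij hmem hnot).1
    simp only [mem_insert, mem_singleton] at this
    rcases this with h | h | h
    · exact (hx x).1 h.symm
    · exact hiW (h ▸ (hg _).1)
    · exact hiW (h ▸ (hg _).1)
  · rw [disjoint_left]
    intro z hz hz'
    simp only [mem_insert, mem_singleton] at hz hz'
    have hgx : ∀ a b, (g (x, a)).1 ≠ (g (y, b)).1 := fun a b h =>
      hxy (Prod.mk.inj (hginj _ _ h)).1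
    rcases hz with rfl | rfl | rfl <;> rcases hz' with h | h | h
    · exact hxy (Subtype.ext h)
    · exact hne x _ h
    · exact hne x _ h
    · exact hne y _ h.symm
    · exact hgx _ _ h
    · exact hgx _ _ h
    · exact hne y _ h.symm
    · exact hgx _ _ h
    · exact hgx _ _ h

/-- The counterpart of `eq_cover_of_compression` for cliques: besides the triples through `i` and
`j` there are `s - 1` disjoint triples that the compression did not change. For `s = 1` the claim
fails, as the clique has only four vertices besides `i` then. -/
lemma eq_clique_of_compression {F : Finset (Finset ℕ)} {V T : Finset ℕ} {s i j : ℕ}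
    (hM : MatchingLE F s) (hs : 2 ≤ s) (hij : i ≠ j) (hj : j ∈ V) (hT : T ⊆ V)
    (hTc : #T = 3 * s + 2) (hF3 : ∀ e ∈ F, #e = 3)
    (hC : UV.compression {i} {j} F = powersetCard 3 T) :
    ∃ T' ⊆ V, #T' = 3 * s + 2 ∧ F = powersetCard 3 T' := by
  have hcard : #F = #(powersetCard 3 T) := by rw [← hC, UV.card_compression]
  by_cases hFC : F ⊆ UV.compression {i} {j} F
  · exact ⟨T, hT, hTc, eq_of_subset_of_card_le (hC ▸ hFC) hcard.ge⟩
  obtain ⟨e, he, heC⟩ := not_subset.1 hFC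
  obtain ⟨hje, hie, heF, heC'⟩ := of_notMem_compression hij he heC
  rw [hC] at heC heC'
  obtain ⟨heT, -⟩ := mem_powersetCard.1 heC'
  have hiT : i ∈ T := heT (mem_insert_self _ _)
  have hQT : e.erase j ⊆ T := (subset_insert _ _).trans heT
  have hjT : j ∉ T := fun h => heC (mem_powersetCard.2 ⟨fun x hx => by
    rcases eq_or_ne x j with rfl | hne
    · exact h
    · exact hQT (mem_erase.2 ⟨hne, hx⟩), hF3 e he⟩)
  have hT'c : #(insert j (T.erase i)) = 3 * s + 2 := by
    rw [card_insert_of_notMem fun h => hjT (mem_of_mem_erase h), card_erase_of_mem hiT]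
    omega
  refine ⟨insert j (T.erase i), insert_subset hj ((erase_subset _ _).trans hT), hT'c,
    eq_of_subset_of_card_le (fun f hf => ?_) ?_⟩
  swap
  · rw [hcard, card_powersetCard, card_powersetCard, hT'c, hTc]
  by_contra hfc
  have hfT' : ¬ f ⊆ insert j (T.erase i) := fun h => hfc (mem_powersetCard.2 ⟨h, hF3 f hf⟩)
  have hfT : i ∈ f ∧ j ∉ f ∧ f ⊆ T := by
    by_cases hfC : f ∈ UV.compression {i} {j} F
    · rw [hC] at hfC
      have hfT := (mem_powersetCard.1 hfC).1
      refine ⟨?_, fun h => hjT (hfT h), hfT⟩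
      by_contra hif
      exact hfT' fun x hx => mem_insert_of_mem (mem_erase.2 ⟨fun h => hif (h ▸ hx), hfT hx⟩)
    · obtain ⟨h1, h2, -, h4⟩ := of_notMem_compression hij hf hfC
      rw [hC] at h4
      exfalso
      refine hfT' fun x hx => ?_
      rcases eq_or_ne x j with rfl | hne
      · exact mem_insert_self _ _
      · refine mem_insert_of_mem (mem_erase.2 ⟨fun h => h2 (h ▸ hx), ?_⟩)
        exact (mem_powersetCard.1 h4).1 (mem_insert_of_mem (mem_erase.2 ⟨hne, hx⟩))
  obtain ⟨hif, hjf, hfT⟩ := hfT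
  set W := T.erase i with hW
  have hWc : #W = 3 * s + 1 := by rw [hW, card_erase_of_mem hiT]; omega
  have hiW : i ∉ W := notMem_erase _ _
  have hjW : j ∉ W := fun h => hjT (mem_of_mem_erase h)
  have hP : f.erase i ∈ powersetCard 2 W :=
    mem_powersetCard.2 ⟨erase_subset_erase _ hfT, by rw [card_erase_of_mem hif, hF3 f hf]⟩
  have hQ : e.erase j ∈ powersetCard 2 W := by
    refine mem_powersetCard.2 ⟨fun x hx => mem_erase.2 ⟨fun h => ?_, hQT hx⟩,
      by rw [card_erase_of_mem hje, hF3 e he]⟩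
    exact hie (h ▸ mem_of_mem_erase hx)
  obtain ⟨P, hPW, Q, hQW, hPQ, hPF, hQF⟩ := exists_disjoint_pairs hij (by omega) hiW
    (fun R hR => by
      obtain ⟨hRW, hRc⟩ := mem_powersetCard.1 hR
      rw [hC]
      refine mem_powersetCard.2 ⟨insert_subset hiT (hRW.trans (erase_subset _ _)), ?_⟩
      rw [card_insert_of_notMem fun h => hiW (hRW h), hRc])
    hP hQ (by rwa [insert_erase hif]) heF
  obtain ⟨hPW, hPc⟩ := mem_powersetCard.1 hPW
  obtain ⟨hQW, hQc⟩ := mem_powersetCard.1 hQW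
  obtain ⟨g⟩ : Nonempty (Fin (s - 1) × Fin 3 ↪ (W \ (P ∪ Q) : Finset ℕ)) := by
    refine Function.Embedding.nonempty_of_card_le ?_
    have h1 := card_union_of_disjoint hPQ
    rw [Fintype.card_prod, Fintype.card_coe, Fintype.card_fin, Fintype.card_fin,
      card_sdiff_of_subset (union_subset hPW hQW)]
    omega
  set A : Fin (s - 1) → Finset ℕ := fun x =>
    univ.map (((Function.Embedding.sectR x (Fin 3)).trans g).trans
      (Function.Embedding.subtype _)) with hA
  have hAmem : ∀ x, ∀ y ∈ A x, ∃ a, y = (g (x, a)).1 := by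
    intro x y hy
    obtain ⟨a, -, rfl⟩ := mem_map.1 hy
    exact ⟨a, rfl⟩
  have hAW : ∀ x, ∀ y ∈ A x, y ∈ W ∧ y ∉ P ∧ y ∉ Q := by
    intro x y hy
    obtain ⟨a, rfl⟩ := hAmem x y hy
    have := mem_sdiff.1 (g (x, a)).2
    rwa [mem_union, not_or] at this
  have hAc : ∀ x, #(A x) = 3 := fun x => by rw [hA]; simp
  have := hM.card_add_two_le (f := A) (fun x => ?_)
    (fun x => card_pos.1 (by rw [hAc]; norm_num)) (fun x y hxy => ?_) hPF hQF (insert_nonempty _ _)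
    (insert_nonempty _ _) (disjoint_insert_insert hij hiW hjW hPW hQW hPQ) (fun x => ?_)
    (fun x => ?_)
  · rw [Fintype.card_fin] at this
    omega
  · have hmem : A x ∈ UV.compression {i} {j} F := by
      rw [hC]
      exact mem_powersetCard.2 ⟨fun y hy => mem_of_mem_erase (hAW x y hy).1, hAc x⟩
    by_contra hnot
    exact hiW (hAW x i (of_mem_compression_of_notMem hij hmem hnot).1).1
  · rw [disjoint_left]
    intro z hz hz'
    obtain ⟨a, rfl⟩ := hAmem x z hz
    obtain ⟨b, hb⟩ := hAmem y _ hz'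
    exact hxy (Prod.mk.inj (g.injective (Subtype.ext hb))).1
  · rw [disjoint_insert_left, disjoint_right]
    exact ⟨fun h => hiW (hAW x i h).1, fun y hy => (hAW x y hy).2.1⟩
  · rw [disjoint_insert_left, disjoint_right]
    exact ⟨fun h => hjW (hAW x j h).1, fun y hy => (hAW x y hy).2.2⟩

/-! ### Families with bounded matching number -/

lemma choose_five_three_lt_extremalSize {n : ℕ} (hn : 10 ≤ n) :
    (3 * 1 + 2).choose 3 < extremalSize n 1 := by
  obtain ⟨m, rfl⟩ : ∃ m, n = m + 1 := ⟨n - 1, by omega⟩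
  have h1 : (9 : ℕ).choose 2 ≤ m.choose 2 := Nat.choose_le_choose 2 (by omega)
  have h2 : Nat.choose 9 2 = 36 := by decide
  have h3 : Nat.choose (3 * 1 + 2) 3 = 10 := by decide
  refine lt_of_lt_of_le ?_ (le_max_left _ _)
  have h4 : (m + 1).choose 3 = m.choose 2 + m.choose 3 := Nat.choose_succ_succ' m 2
  rw [Nat.add_sub_cancel]
  omega

/-- The bound for arbitrary families. A family that is not shifted is compressed, and induction on
the sum of all elements of all members applies to the compressed family. -/
theorem extremal : ∃ n₀ : ℕ, ∀ s n, n₀ ≤ n → 1 ≤ s → 3 * s + 2 ≤ n →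
    ∀ F ⊆ powersetCard 3 (range n), MatchingLE F s →
      #F ≤ extremalSize n s ∧ (#F = extremalSize n s →
        (∃ S ⊆ range n, #S = s ∧ F = coverFamily (range n) S) ∨
        ∃ T ⊆ range n, #T = 3 * s + 2 ∧ F = powersetCard 3 T) := by
  obtain ⟨n₀, h₀⟩ := shifted_extremal
  refine ⟨2 * n₀ + 10, fun s n hn hs hsn => ?_⟩
  rcases hsn.eq_or_lt with hsn' | hlt
  · intro F h3 _
    have hF : #F ≤ (3 * s + 2).choose 3 := by
      have := card_le_card h3
      rwa [card_powersetCard, card_range, ← hsn'] at this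
    refine ⟨hF.trans (le_max_right _ _), fun h => Or.inr ⟨range n, Subset.rfl, by simp [hsn'],
      eq_of_subset_of_card_le h3 ?_⟩⟩
    rw [h, card_powersetCard, card_range, ← hsn']
    exact le_max_right _ _
  suffices H : ∀ w, ∀ F ⊆ powersetCard 3 (range n), ∑ a ∈ F, ∑ x ∈ a, x = w → MatchingLE F s →
      #F ≤ extremalSize n s ∧ (#F = extremalSize n s →
        (∃ S ⊆ range n, #S = s ∧ F = coverFamily (range n) S) ∨
        ∃ T ⊆ range n, #T = 3 * s + 2 ∧ F = powersetCard 3 T) from fun F h3 => H _ F h3 rfl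
  intro w
  induction w using Nat.strong_induction_on with
  | _ w ih =>
    rintro F h3 rfl hM
    by_cases hF : IsShifted F
    · obtain ⟨h1, h2⟩ := h₀ s n (by omega) hlt F h3 hF hM
      refine ⟨h1, fun h => (h2 h).imp (fun h => ?_) fun h => ?_⟩
      · exact ⟨range s, range_subset_range.2 (by omega), card_range s, h⟩
      · exact ⟨range (3 * s + 2), range_subset_range.2 hsn, card_range _, h⟩
    · simp only [IsShifted, not_forall] at hF
      obtain ⟨e, he, i, j, hij, hje, hie, heF⟩ := hF
      have hj : j ∈ range n := (mem_powersetCard.1 (h3 he)).1 hje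
      have hi : i ∈ range n := mem_range.2 (hij.trans (mem_range.1 hj))
      obtain ⟨h1, h2⟩ := ih _ (sum_compression_lt hij he hje hie heF) _ (compression_subset h3 hi)
        rfl (hM.compression hij.ne)
      rw [UV.card_compression] at h1 h2
      refine ⟨h1, fun h => ?_⟩
      rcases h2 h with ⟨S, hS, hSc, hC⟩ | ⟨T, hT, hTc, hC⟩
      · exact Or.inl (eq_cover_of_compression hM h3 (by rw [card_range]; omega)
          (by rw [card_range]; omega) hij.ne hj hS hSc hC)
      · have hs2 : 2 ≤ s := by
          by_contra hs2
          obtain rfl : s = 1 := by omega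
          have := choose_five_three_lt_extremalSize (n := n) (by omega)
          rw [← h, ← UV.card_compression {i} {j}, hC, card_powersetCard, hTc] at this
          exact this.false
        exact Or.inr (eq_clique_of_compression hM hs2 hij.ne hj hT hTc
          (fun e he => (mem_powersetCard.1 (h3 he)).2) hC)

/-! ### Hypergraphs as families of finite sets -/

lemma MatchingLE.map {α β : Type*} {F : Finset (Finset α)} {s : ℕ} (hF : MatchingLE F s)
    (π : α ≃ β) : MatchingLE (F.map (mapEmbedding π.toEmbedding).toEmbedding) s := by
  intro M hM hd
  obtain ⟨M, hMF, rfl⟩ := subset_map_iff.1 hM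
  rw [card_map]
  refine hF M hMF fun a ha b hb hab => ?_
  exact (disjoint_map π.toEmbedding).1 (hd (mem_map_of_mem _ ha) (mem_map_of_mem _ hb)
    fun h => hab ((mapEmbedding π.toEmbedding).injective h))

lemma coverFamily_map (V S : Finset ℕ) (π : Equiv.Perm ℕ) :
    coverFamily (V.map π.toEmbedding) (S.map π.toEmbedding) =
      (coverFamily V S).map (mapEmbedding π.toEmbedding).toEmbedding := by
  rw [coverFamily, powersetCard_map, filter_map, coverFamily]
  congr 1
  refine filter_congr fun e _ => ?_
  exact not_congr (disjoint_map _)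

/-- The bound for families of triples in an arbitrary vertex set. -/
theorem extremal_finset : ∃ n₀ : ℕ, ∀ s, ∀ V : Finset ℕ, n₀ ≤ #V → 1 ≤ s → 3 * s + 2 ≤ #V →
    ∀ F ⊆ powersetCard 3 V, MatchingLE F s →
      #F ≤ extremalSize #V s ∧ (#F = extremalSize #V s →
        (∃ S ⊆ V, #S = s ∧ F = coverFamily V S) ∨
        ∃ T ⊆ V, #T = 3 * s + 2 ∧ F = powersetCard 3 T) := by
  obtain ⟨n₀, h₀⟩ := extremal
  refine ⟨n₀, fun s V hn hs hsn F h3 hM => ?_⟩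
  obtain ⟨π, hπ⟩ := exists_perm_map_eq (card_range #V)
  have hinv : ∀ A : Finset ℕ, (A.map π.symm.toEmbedding).map π.toEmbedding = A := fun A => by
    rw [map_map]; convert map_refl; ext x; simp
  have hinv' : ∀ A : Finset ℕ, (A.map π.toEmbedding).map π.symm.toEmbedding = A := fun A => by
    rw [map_map]; convert map_refl; ext x; simp
  set n := #V
  have hF : (F.map (mapEmbedding π.symm.toEmbedding).toEmbedding).map
      (mapEmbedding π.toEmbedding).toEmbedding = F := by
    rw [map_map]; convert map_refl; ext1 x; exact hinv x
  obtain ⟨h1, h2⟩ := h₀ s n hn hs hsn (F.map (mapEmbedding π.symm.toEmbedding).toEmbedding) (by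
    have := map_subset_map (f := (mapEmbedding π.symm.toEmbedding).toEmbedding) |>.2 h3
    rwa [← powersetCard_map, ← hπ, hinv'] at this) (hM.map π.symm)
  rw [card_map] at h1 h2
  refine ⟨h1, fun h => (h2 h).imp ?_ ?_⟩
  · rintro ⟨S, hS, hSc, hC⟩
    refine ⟨S.map π.toEmbedding, hπ ▸ map_subset_map.2 hS, by rw [card_map, hSc], ?_⟩
    rw [← hF, hC, ← coverFamily_map, hπ]
  · rintro ⟨T, hT, hTc, hC⟩
    refine ⟨T.map π.toEmbedding, hπ ▸ map_subset_map.2 hT, by rw [card_map, hTc], ?_⟩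
    rw [← hF, hC, powersetCard_map]

lemma matchingLE_coverFamily (V S : Finset ℕ) : MatchingLE (coverFamily V S) #S := by
  intro M hM hd
  have h : ∀ e ∈ M, ∃ x ∈ S, x ∈ e := fun e he => by
    obtain ⟨x, hx, hx'⟩ := not_disjoint_iff.1 (mem_filter.1 (hM he)).2
    exact ⟨x, hx', hx⟩
  choose! f hfS hfe using h
  refine card_le_card_of_injOn f hfS fun a ha b hb hab => ?_
  by_contra hne
  exact disjoint_left.1 (hd ha hb hne) (hfe a ha) (hab ▸ hfe b hb)

lemma matchingLE_powersetCard (T : Finset ℕ) : MatchingLE (powersetCard 3 T) (#T / 3) := by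
  intro M hM hd
  have h1 : #(M.biUnion id) = ∑ e ∈ M, #e := card_biUnion fun a ha b hb hab => hd ha hb hab
  rw [sum_const_nat fun e he => (mem_powersetCard.1 (hM he)).2] at h1
  have h2 := card_le_card (biUnion_subset.2 fun e he => (mem_powersetCard.1 (hM he)).1 :
    M.biUnion id ⊆ T)
  omega

/-- `s` disjoint triples in `{0, …, 3s - 1}`, each with exactly one element smaller than `s`. -/
lemma exists_transversal_matching (s : ℕ) : ∃ M ⊆ powersetCard 3 (range (3 * s)),
    (M : Set (Finset ℕ)).PairwiseDisjoint id ∧ #M = s ∧ ∀ e ∈ M, ¬ Disjoint e (range s) := by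
  have hmem : ∀ x : ℕ, ∀ y, y ∈ ({x, s + 2 * x, s + 2 * x + 1} : Finset ℕ) ↔
      y = x ∨ y = s + 2 * x ∨ y = s + 2 * x + 1 := by simp
  refine ⟨(range s).image fun x => {x, s + 2 * x, s + 2 * x + 1}, ?_, ?_, ?_, ?_⟩
  · intro e he
    obtain ⟨x, hx, rfl⟩ := mem_image.1 he
    have hx := mem_range.1 hx
    refine mem_powersetCard.2 ⟨fun y hy => ?_, ?_⟩
    · rw [hmem] at hy; rw [mem_range]; omega
    · exact card_eq_three.2 ⟨_, _, _, by omega, by omega, by omega, rfl⟩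
  · intro a ha b hb hab
    obtain ⟨x, hx, rfl⟩ := mem_image.1 (mem_coe.1 ha)
    obtain ⟨y, hy, rfl⟩ := mem_image.1 (mem_coe.1 hb)
    have hx := mem_range.1 hx
    have hy := mem_range.1 hy
    have hxy : x ≠ y := fun h => hab (by rw [h])
    change Disjoint _ _
    simp only [id]
    rw [disjoint_left]
    intro z hz hz'
    rw [hmem] at hz hz'
    omega
  · rw [card_image_of_injOn, card_range]
    intro x hx y hy hxy
    have hx := mem_range.1 (mem_coe.1 hx)
    have hy := mem_range.1 (mem_coe.1 hy)
    have h : x ∈ ({y, s + 2 * y, s + 2 * y + 1} : Finset ℕ) :=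
      (Finset.ext_iff.1 hxy x).1 (mem_insert_self _ _)
    rw [hmem] at h
    omega
  · intro e he
    obtain ⟨x, hx, rfl⟩ := mem_image.1 he
    exact not_disjoint_iff.2 ⟨x, mem_insert_self _ _, hx⟩

lemma coe_finset_injective : Function.Injective (fun e : Finset ℕ => (e : Set ℕ)) :=
  coe_injective

lemma pairwiseDisjoint_image_coe {M : Finset (Finset ℕ)} :
    ((fun e : Finset ℕ => (e : Set ℕ)) '' (M : Set (Finset ℕ))).PairwiseDisjoint id ↔
      (M : Set (Finset ℕ)).PairwiseDisjoint id := by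
  rw [coe_finset_injective.injOn.pairwiseDisjoint_image]
  refine ⟨fun h a ha b hb hab => ?_, fun h a ha b hb hab => ?_⟩
  · exact disjoint_coe.1 (h ha hb hab)
  · exact disjoint_coe.2 (h ha hb hab)

/-- If the edges of `G` are the members of the finite family `F`, then the matchings of `G` are
the families of disjoint members of `F`. -/
lemma hasMatchingNumber_iff {G : Hypergraph ℕ} {F : Finset (Finset ℕ)}
    (hG : G.edgeSet = (fun e : Finset ℕ => (e : Set ℕ)) '' (F : Set (Finset ℕ))) {s : ℕ} :
    G.HasMatchingNumber s ↔
      (∃ M ⊆ F, (M : Set (Finset ℕ)).PairwiseDisjoint id ∧ #M = s) ∧ MatchingLE F s := by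
  have key : ∀ M, G.IsMatching M ↔ ∃ M' ⊆ F, (M' : Set (Finset ℕ)).PairwiseDisjoint id ∧
      (fun e : Finset ℕ => (e : Set ℕ)) '' (M' : Set (Finset ℕ)) = M := by
    intro M
    rw [Hypergraph.IsMatching, hG]
    constructor
    · rintro ⟨h1, h2⟩
      obtain ⟨M', hM', rfl⟩ := Set.subset_image_iff.1 h1
      lift M' to Finset (Finset ℕ) using F.finite_toSet.subset hM'
      exact ⟨M', coe_subset.1 hM', pairwiseDisjoint_image_coe.1 h2, rfl⟩
    · rintro ⟨M', h1, h2, rfl⟩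
      exact ⟨Set.image_mono (coe_subset.2 h1), pairwiseDisjoint_image_coe.2 h2⟩
  have hcard : ∀ M : Finset (Finset ℕ),
      ((fun e : Finset ℕ => (e : Set ℕ)) '' (M : Set (Finset ℕ))).encard = #M := fun M => by
    rw [coe_finset_injective.encard_image, Set.encard_coe_eq_coe_finsetCard]
  refine and_congr ⟨?_, ?_⟩ ⟨?_, ?_⟩
  · rintro ⟨M, hM, hMs⟩
    obtain ⟨M, h1, h2, rfl⟩ := (key M).1 hM
    rw [hcard] at hMs
    exact ⟨M, h1, h2, by exact_mod_cast hMs⟩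
  · rintro ⟨M, h1, h2, h3⟩
    exact ⟨_, (key _).2 ⟨M, h1, h2, rfl⟩, by rw [hcard, h3]⟩
  · intro h M h1 h2
    have := h _ ((key _).2 ⟨M, h1, h2, rfl⟩)
    rw [hcard] at this
    exact_mod_cast this
  · intro h M hM
    obtain ⟨M, h1, h2, rfl⟩ := (key M).1 hM
    rw [hcard]
    exact_mod_cast h M h1 h2

lemma edgeCount_eq_card {G : Hypergraph ℕ} {F : Finset (Finset ℕ)}
    (hG : G.edgeSet = (fun e : Finset ℕ => (e : Set ℕ)) '' (F : Set (Finset ℕ))) :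
    G.edgeCount = #F := by
  rw [Hypergraph.edgeCount, hG, Set.ncard_image_of_injective _ coe_finset_injective,
    Set.ncard_coe_finset]

/-- The hypergraph on `V` whose edges are the members of `F`. -/
def toHypergraph {V : Finset ℕ} {F : Finset (Finset ℕ)} (h : F ⊆ powersetCard 3 V) :
    Hypergraph ℕ where
  vertexSet := V
  edgeSet := (fun e : Finset ℕ => (e : Set ℕ)) '' (F : Set (Finset ℕ))
  subset_vertexSet_of_mem_edgeSet' := by
    rintro _ ⟨e, he, rfl⟩
    exact coe_subset.2 (mem_powersetCard.1 (h he)).1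

lemma toHypergraph_mem_graphClass {n s : ℕ} {F : Finset (Finset ℕ)}
    (h : F ⊆ powersetCard 3 (range n)) (hF : MatchingLE F s)
    (hF' : ∀ e ∈ powersetCard 3 (range (3 * s)), ¬ Disjoint e (range s) → e ∈ F) :
    toHypergraph h ∈ Hypergraph.graphClass 3 n s := by
  refine ⟨?_, ?_, (hasMatchingNumber_iff rfl).2 ⟨?_, hF⟩⟩
  · rintro _ ⟨e, he, rfl⟩
    simp only [Set.encard_coe_eq_coe_finsetCard, (mem_powersetCard.1 (h he)).2]
  · change ((range n : Finset ℕ) : Set ℕ).encard = n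
    rw [Set.encard_coe_eq_coe_finsetCard, card_range]
  · obtain ⟨M, hM, hd, hMc, hMS⟩ := exists_transversal_matching s
    exact ⟨M, fun e he => hF' e (hM he) (hMS e he), hd, hMc⟩

lemma exists_edgeCount_eq_extremalSize {n s : ℕ} (hn : 3 * s + 2 ≤ n) :
    ∃ G ∈ Hypergraph.graphClass 3 n s, G.edgeCount = extremalSize n s := by
  have hsn : range s ⊆ range n := range_subset_range.2 (by omega)
  rcases max_choice (n.choose 3 - (n - s).choose 3) ((3 * s + 2).choose 3) with h | h
  · have hsub : coverFamily (range n) (range s) ⊆ powersetCard 3 (range n) := filter_subset _ _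
    refine ⟨_, toHypergraph_mem_graphClass hsub ?_ ?_, ?_⟩
    · have := matchingLE_coverFamily (range n) (range s)
      rwa [card_range] at this
    · exact fun e he hes => mem_filter.2
        ⟨powersetCard_mono (range_subset_range.2 (by omega)) he, hes⟩
    · rw [edgeCount_eq_card rfl, card_coverFamily hsn, card_range, card_range, extremalSize, h]
  · refine ⟨_, toHypergraph_mem_graphClass (powersetCard_mono (range_subset_range.2 hn) :
      powersetCard 3 (range (3 * s + 2)) ⊆ _) ?_ ?_, ?_⟩
    · have := matchingLE_powersetCard (range (3 * s + 2))
      rwa [card_range, show (3 * s + 2) / 3 = s by omega] at this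
    · exact fun e he _ => powersetCard_mono (range_subset_range.2 (by omega)) he
    · rw [edgeCount_eq_card rfl, card_powersetCard, card_range, extremalSize, h]

lemma exists_family_of_mem_graphClass {G : Hypergraph ℕ} {n s : ℕ}
    (hG : G ∈ Hypergraph.graphClass 3 n s) : ∃ V : Finset ℕ, ∃ F ⊆ powersetCard 3 V,
      G.vertexSet = V ∧ #V = n ∧
      G.edgeSet = (fun e : Finset ℕ => (e : Set ℕ)) '' (F : Set (Finset ℕ)) ∧ MatchingLE F s := by
  classical
  obtain ⟨h3, hV, hM⟩ := hG
  obtain ⟨V, hVG⟩ : ∃ V : Finset ℕ, G.vertexSet = V :=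
    ⟨(Set.finite_of_encard_eq_coe hV).toFinset, by simp⟩
  rw [hVG, Set.encard_coe_eq_coe_finsetCard] at hV
  have hE : G.edgeSet = (fun e : Finset ℕ => (e : Set ℕ)) ''
      (({e ∈ powersetCard 3 V | (e : Set ℕ) ∈ G.edgeSet} : Finset (Finset ℕ)) :
        Set (Finset ℕ)) := by
    ext e
    constructor
    · intro he
      have heV := G.subset_vertexSet_of_mem_edgeSet' he
      rw [hVG] at heV
      lift e to Finset ℕ using V.finite_toSet.subset heV
      have hec := h3 _ he
      rw [Set.encard_coe_eq_coe_finsetCard] at hec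
      exact ⟨e, mem_coe.2 (mem_filter.2 ⟨mem_powersetCard.2
        ⟨coe_subset.1 heV, by exact_mod_cast hec⟩, he⟩), rfl⟩
    · rintro ⟨e, he, rfl⟩
      exact (mem_filter.1 (mem_coe.1 he)).2
  exact ⟨V, _, filter_subset _ _, hVG, by exact_mod_cast hV, hE,
    ((hasMatchingNumber_iff hE).1 hM).2⟩

lemma mem_coverClass {G : Hypergraph ℕ} {V S : Finset ℕ} {s : ℕ} (hV : G.vertexSet = V)
    (hS : S ⊆ V) (hSc : #S = s)
    (hG : G.edgeSet = (fun e : Finset ℕ => (e : Set ℕ)) '' (coverFamily V S : Set (Finset ℕ))) :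
    G ∈ Hypergraph.coverClass 3 #V s := by
  refine ⟨by rw [hV, Set.encard_coe_eq_coe_finsetCard], S, by rw [hV]; exact coe_subset.2 hS,
    by rw [Set.encard_coe_eq_coe_finsetCard, hSc], ?_⟩
  rw [hG, hV]
  ext e
  constructor
  · rintro ⟨e, he, rfl⟩
    obtain ⟨he, heS⟩ := mem_filter.1 (mem_coe.1 he)
    obtain ⟨heV, hec⟩ := mem_powersetCard.1 he
    obtain ⟨x, hx, hxS⟩ := not_disjoint_iff.1 heS
    exact ⟨coe_subset.2 heV, ⟨x, hx, hxS⟩, by simp [Set.encard_coe_eq_coe_finsetCard, hec]⟩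
  · rintro ⟨heV, ⟨x, hx, hxS⟩, hec⟩
    lift e to Finset ℕ using V.finite_toSet.subset heV
    rw [Set.encard_coe_eq_coe_finsetCard] at hec
    exact ⟨e, mem_coe.2 (mem_filter.2 ⟨mem_powersetCard.2 ⟨coe_subset.1 heV,
      by exact_mod_cast hec⟩, not_disjoint_iff.2 ⟨x, hx, hxS⟩⟩), rfl⟩

lemma mem_cliqueClass {G : Hypergraph ℕ} {V T : Finset ℕ} {s : ℕ} (hV : G.vertexSet = V)
    (hT : T ⊆ V) (hTc : #T = 3 * s + 2)
    (hG : G.edgeSet = (fun e : Finset ℕ => (e : Set ℕ)) '' (powersetCard 3 T : Set (Finset ℕ))) :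
    G ∈ Hypergraph.cliqueClass 3 #V s := by
  refine ⟨by rw [hV, Set.encard_coe_eq_coe_finsetCard], T, by rw [hV]; exact coe_subset.2 hT,
    by rw [Set.encard_coe_eq_coe_finsetCard, hTc]; rfl, ?_⟩
  rw [hG]
  ext e
  constructor
  · rintro ⟨e, he, rfl⟩
    obtain ⟨heT, hec⟩ := mem_powersetCard.1 (mem_coe.1 he)
    exact ⟨coe_subset.2 heT, by simp [Set.encard_coe_eq_coe_finsetCard, hec]⟩
  · rintro ⟨heT, hec⟩
    lift e to Finset ℕ using T.finite_toSet.subset heT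
    rw [Set.encard_coe_eq_coe_finsetCard] at hec
    exact ⟨e, mem_coe.2 (mem_powersetCard.2 ⟨coe_subset.1 heT, by exact_mod_cast hec⟩), rfl⟩

end ErdosMatching

theorem theorem1 :
    ∃ n₀ : ℕ, ∀ n s : ℕ, n₀ ≤ n → 1 ≤ s → (s : ℝ) ≤ ((n : ℝ) - 2) / 3 →
      IsGreatest (Hypergraph.edgeCount '' Hypergraph.graphClass 3 n s)
        (max (n.choose 3 - (n - s).choose 3) ((3 * s + 2).choose 3)) ∧
      Hypergraph.extremalClass 3 n s ⊆
        Hypergraph.coverClass 3 n s ∪ Hypergraph.cliqueClass 3 n s := by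
  obtain ⟨n₀, h₀⟩ := ErdosMatching.extremal_finset
  refine ⟨n₀, fun n s hn hs hsn => ?_⟩
  have hsn : 3 * s + 2 ≤ n := by
    have : (3 * s + 2 : ℝ) ≤ n := by linarith
    exact_mod_cast this
  obtain ⟨G₀, hG₀, hG₀c⟩ := ErdosMatching.exists_edgeCount_eq_extremalSize hsn
  refine ⟨⟨⟨G₀, hG₀, hG₀c⟩, ?_⟩, ?_⟩
  · rintro _ ⟨G, hG, rfl⟩
    obtain ⟨V, F, h3, hV, rfl, hE, hM⟩ := ErdosMatching.exists_family_of_mem_graphClass hG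
    rw [ErdosMatching.edgeCount_eq_card hE]
    exact (h₀ s V hn hs hsn F h3 hM).1
  · rintro G ⟨hG, hmax⟩
    obtain ⟨V, F, h3, hV, rfl, hE, hM⟩ := ErdosMatching.exists_family_of_mem_graphClass hG
    obtain ⟨h1, h2⟩ := h₀ s V hn hs hsn F h3 hM
    have h4 := hmax G₀ hG₀
    rw [hG₀c, ErdosMatching.edgeCount_eq_card hE] at h4
    rcases h2 (h1.antisymm h4) with ⟨S, hS, hSc, rfl⟩ | ⟨T, hT, hTc, rfl⟩
    · exact Or.inl (ErdosMatching.mem_coverClass hV hS hSc hE)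
    · exact Or.inr (ErdosMatching.mem_cliqueClass hV hT hTc hE)
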